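/- **Theorem (The Beck Gain).** For integers $s\ge 0$ and $0\le j<2^s$ let $h_{s,j}$ be the function on $\mathbb R$ that is $-1$ on the left half of $[j2^{-s},(j+1)2^{-s})$, $+1$ on its right half, and $0$ elsewhere. For $\vec r=(r_1,r_2,r_3)\in\mathbb Z_{\ge 0}^3$, an *$\mathsf r$-function with parameter $\vec r$* is a function on $[0,1]^3$ of the form $$ f(x)=\sum_{R}\varepsilon_R\,h_R(x),\qquad \varepsilon_R\in\{\pm1\},$$ where $R$ runs over the dyadic rectangles $R=\prod_{k=1}^3[j_k2^{-r_k},(j_k+1)2^{-r_k})\subset[0,1)^3$ and $h_R(x)=\prod_{k=1}^3h_{r_k,j_k}(x_k)$. Let $\mathbb H_n$ be the set of $\vec r\in\mathbb Z_{\ge0}^3$ with $r_1+r_2+r_3=n$. Divide $\{1,\dots,n\}$ into $q$ consecutive disjoint nonempty intervals $I_1,\dots,I_q$, and put $\mathbb A_t=\{\vec r\in\mathbb H_n: r_1\in I_t\}$ and $\rho=\sqrt q\,n^{-1}$. For each $\vec r\in\mathbb H_n$ let $f_{\vec r}$ be an $\mathsf r$-function with parameter $\vec r$. For $V\subset\{1,\dots,q\}$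 let $\operatorname{NSD}(V)$ be the set of tuples $(\vec r_j)_{j\in V}\in\prod_{j\in V}\mathbb A_j$ such that for every $j\in V$ there are $j'\in V\setminus\{j\}$ and $\ell\in\{2,3\}$ with $r_{j,\ell}=r_{j',\ell}$, and let $$\operatorname{Prod}(\operatorname{NSD}(V))=\sum_{(\vec r_j)\in\operatorname{NSD}(V)}\ \prod_{j\in V}f_{\vec r_j}.$$ Then there are absolute constants $C_0,C_1,C_2,C_3,\eta>0$ such that, for all $n\ge1$, all $q$, all such divisions $I_1,\dots,I_q$, all such choices of the functions $f_{\vec r}$, all $V\subset\{1,\dots,q\}$ and all $1\le p<\infty$, $$\rho^{|V|}\,\bigl\|\operatorname{Prod}(\operatorname{NSD}(V))\bigr\|_{L^p([0,1]^3)}\le\bigl[C_0\,|V|^{C_1}\,p^{C_2}\,q^{C_3}\,n^{-\eta}\bigr]^{|V|},$$ where the right-hand side is read as $1$ when $V=\emptyset$ (in which case $\operatorname{Prod}(\operatorname{NSD}(V))=1$). -/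

import Mathlib

namespace BeckGain

open MeasureTheory

noncomputable section

/-- The dyadic interval `[j 2⁻ˢ, (j+1) 2⁻ˢ)`. -/
def dyadicInterval (s j : ℕ) : Set ℝ :=
  Set.Ico ((j : ℝ) / 2 ^ s) (((j : ℝ) + 1) / 2 ^ s)

/-- The `L^∞`-normalized Haar function of the interval `dyadicInterval s j`:
`-1` on its left half, `+1` on its right half, `0` elsewhere. -/
def haar (s j : ℕ) (x : ℝ) : ℝ :=
  -(dyadicInterval (s + 1) (2 * j)).indicator 1 x +
    (dyadicInterval (s + 1) (2 * j + 1)).indicator 1 x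

/-- The dyadic rectangles in the unit cube `[0,1)³` with side lengths `2^{-r 0}, 2^{-r 1}, 2^{-r 2}`,
given by the positions of their sides. -/
abbrev Rect (r : Fin 3 → ℕ) : Type := (k : Fin 3) → Fin (2 ^ r k)

/-- The tensor product Haar function of a dyadic rectangle. -/
def haarRect (r : Fin 3 → ℕ) (R : Rect r) (x : Fin 3 → ℝ) : ℝ :=
  ∏ k, haar (r k) (R k) (x k)

/-- `f` is an r-function with parameter `r`. -/
def IsRFunction (r : Fin 3 → ℕ) (f : (Fin 3 → ℝ) → ℝ) : Prop :=
  ∃ ε : Rect r → ℝ, (∀ R, ε R = 1 ∨ ε R = -1) ∧ ∀ x, f x = ∑ R, ε R * haarRect r R x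

end

/-- The hyperbolic vectors: triples of nonnegative integers with sum `n`.
The coordinates are indexed by `0, 1, 2`. -/
def hyp (n : ℕ) : Finset (Fin 3 → ℕ) := Finset.Nat.antidiagonalTuple 3 n

/-- `I` divides `{1, …, n}` into `q` (nonempty, disjoint) consecutive intervals. -/
structure IsIntervalDivision (n : ℕ) {q : ℕ} (I : Fin q → Finset ℕ) : Prop where
  interval : ∀ t, ∃ a b : ℕ, a ≤ b ∧ I t = Finset.Icc a b
  increasing : ∀ s t, s < t → ∀ x ∈ I s, ∀ y ∈ I t, x < y
  cover : ∀ x, x ∈ Finset.Icc 1 n ↔ ∃ t, x ∈ I t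

/-- The hyperbolic vectors whose first coordinate lies in the `t`-th interval. -/
def block (n : ℕ) {q : ℕ} (I : Fin q → Finset ℕ) (t : Fin q) : Finset (Fin 3 → ℕ) :=
  (hyp n).filter fun r => r 0 ∈ I t

/-- Tuples `(r_j)_{j ∈ V}` with `r_j` in the `j`-th block in which every `r_j` agrees with some other
`r_{j'}` in the second or in the third coordinate. -/
def NSD (n : ℕ) {q : ℕ} (I : Fin q → Finset ℕ) (V : Finset (Fin q)) :
    Finset (V → Fin 3 → ℕ) :=
  (Fintype.piFinset fun j : V => block n I j).filter fun r =>
    ∀ j : V, ∃ j' : V, j' ≠ j ∧ (r j 1 = r j' 1 ∨ r j 2 = r j' 2)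

noncomputable section

/-- The sum, over the tuples in `C`, of the products of the functions `f r_j`. -/
def sumProd {ι : Type*} [Fintype ι] (f : (Fin 3 → ℕ) → (Fin 3 → ℝ) → ℝ)
    (C : Finset (ι → Fin 3 → ℕ)) (x : Fin 3 → ℝ) : ℝ :=
  ∑ r ∈ C, ∏ j, f (r j) x

/-- Lebesgue measure on the unit cube `[0,1]³`. -/
def cubeMeasure : Measure (Fin 3 → ℝ) := volume.restrict (Set.Icc 0 1)

/-- The normalization `ρ = √q / n`. -/
def rho (q n : ℕ) : ℝ := Real.sqrt q / n

end

end BeckGain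

/-! A vector of `hyp n` is determined by its last two coordinates `(a, b)`, so a tuple in `NSD` is a
pair of functions `a, b : V → Fin (n + 1)`. Fixing the fibres of `a` and of `b` gives a bipartite
multigraph: its vertices are the fibres (`A` for the second coordinate, `B` for the third), its
edges are the indices `j ∈ V`, and no edge is isolated. Each kernel pair contributes a sum over one
parameter per vertex. The normalization allows one factor `n` per edge, so the goal is a bound of
order `n ^ (15/16)` per edge, up to powers of `|V|` and `p`.

The sum factors over connected components, and a component with `v` edges has `|A| + |B| ≤ v + 1`
(`card_add_card_le_of_connected`). Fix all parameters in the smaller class, say `A`. Each remaining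
sum, over a vertex of `B`, is a martingale difference sum in the first variable: the blocks order
the first coordinates strictly, so the last edge at the vertex has the finest scale.
Littlewood–Paley (`MomentLE.of_square`) therefore bounds it by a square root, and the component by
`n ^ (|A| + |B|/2)` (`HaarSystem.freeSum_columns`). This suffices except when `(|A|, |B|, v)` is
`(1, 2, 2)` or `(2, 2, 3)`.

Both exceptions contain two edges that share an `A`-vertex, the true Beck gain (`HaarSystem.pair`).
Expanding the square function over the shared parameter leaves off-diagonal terms `∑ c, h c a * h c
a'`, which are again martingale difference sums, now in another variable. The path with three edges
is this pair with a further edge attached.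

Distinct fibres must carry distinct values. This is achieved by averaging over random colourings
(`sum_injective_eq`), at the cost of a factor polynomial in `|V|` per edge. Everything takes place
on a finite dyadic grid, where flips of binary digits replace conditional expectations. -/

namespace BeckGain
open Finset

/-! ### Moments on a finite probability space -/

section Moments

variable {Ω : Type*} [Fintype Ω]

/-- The normalized `k`-th absolute moment of `F` on the finite space `Ω` is at most `A ^ k`. -/
def MomentLE (k : ℕ) (F : Ω → ℝ) (A : ℝ) : Prop :=
  ∑ ω, |F ω| ^ k ≤ A ^ k * Fintype.card Ω

theorem MomentLE.mono {k : ℕ} {F : Ω → ℝ} {A B : ℝ} (h : MomentLE k F A) (hA : 0 ≤ A)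
    (hAB : A ≤ B) : MomentLE k F B :=
  le_trans h (by gcongr)

theorem MomentLE.of_abs_le {k : ℕ} {F : Ω → ℝ} {A : ℝ} (h : ∀ ω, |F ω| ≤ A) :
    MomentLE k F A := by
  calc ∑ ω, |F ω| ^ k ≤ ∑ _ω : Ω, A ^ k := sum_le_sum fun ω _ => by
        gcongr
        exact h ω
    _ = A ^ k * Fintype.card Ω := by simp [mul_comm]

theorem MomentLE.const_mul {k : ℕ} {F : Ω → ℝ} {A : ℝ} (h : MomentLE k F A) (c : ℝ) :
    MomentLE k (fun ω => c * F ω) (|c| * A) := by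
  unfold MomentLE at *
  simp only [abs_mul, mul_pow, ← mul_sum, mul_assoc]
  gcongr

theorem MomentLE.sum {ι : Type*} {k : ℕ} {s : Finset ι} {F : ι → Ω → ℝ} {A : ℝ} (hk : 1 ≤ k)
    (h : ∀ i ∈ s, MomentLE k (F i) A) : MomentLE k (fun ω => ∑ i ∈ s, F i ω) (#s * A) := by
  obtain ⟨k, rfl⟩ : ∃ l, k = l + 1 := ⟨k - 1, by omega⟩
  unfold MomentLE at *
  calc ∑ ω, |∑ i ∈ s, F i ω| ^ (k + 1) ≤ ∑ ω, (#s : ℝ) ^ k * ∑ i ∈ s, |F i ω| ^ (k + 1) := by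
        refine sum_le_sum fun ω _ => ?_
        calc |∑ i ∈ s, F i ω| ^ (k + 1) ≤ (∑ i ∈ s, |F i ω|) ^ (k + 1) := by
              gcongr
              exact abs_sum_le_sum_abs _ _
          _ ≤ _ := pow_sum_le_card_mul_sum_pow (fun _ _ => abs_nonneg _) k
    _ = (#s : ℝ) ^ k * ∑ i ∈ s, ∑ ω, |F i ω| ^ (k + 1) := by rw [← mul_sum, sum_comm]
    _ ≤ (#s : ℝ) ^ k * ∑ _i ∈ s, A ^ (k + 1) * Fintype.card Ω := by
        gcongr with i hi
        exact h i hi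
    _ = _ := by simp only [sum_const, nsmul_eq_mul]; ring

theorem prod_le_sum_pow_card_div {ι : Type*} {s : Finset ι} (hs : s.Nonempty) {y : ι → ℝ}
    (hy : ∀ i, 0 ≤ y i) : ∏ i ∈ s, y i ≤ (∑ i ∈ s, y i ^ #s) / #s := by
  have hc : (#s : ℝ) ≠ 0 := by exact_mod_cast hs.card_pos.ne'
  have := Real.geom_mean_le_arith_mean_weighted s (fun _ => ((#s : ℝ))⁻¹) (fun i => y i ^ #s)
    (fun _ _ => by positivity) (by simp [hc]) (fun i _ => by have := hy i; positivity)
  simpa [Real.pow_rpow_inv_natCast (hy _) hs.card_pos.ne', ← mul_sum, div_eq_inv_mul] using this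

/-- Hölder's inequality with equal exponents. After division by the bounds `A i`, it is the
pointwise inequality of geometric and arithmetic means, which is why the `A i` are strictly
positive. -/
theorem MomentLE.prod {ι : Type*} {k : ℕ} {s : Finset ι} {F : ι → Ω → ℝ} {A : ι → ℝ}
    (hA : ∀ i, 0 < A i) (h : ∀ i ∈ s, MomentLE (k * #s) (F i) (A i)) :
    MomentLE k (fun ω => ∏ i ∈ s, F i ω) (∏ i ∈ s, A i) := by
  rcases s.eq_empty_or_nonempty with rfl | hs
  · exact MomentLE.of_abs_le (by simp)
  have hP : 0 < (∏ i ∈ s, A i) ^ k := pow_pos (prod_pos fun i _ => hA i) _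
  have hc : (0 : ℝ) < #s := by exact_mod_cast hs.card_pos
  have key : ∀ ω, |∏ i ∈ s, F i ω| ^ k
      ≤ (∏ i ∈ s, A i) ^ k * ((∑ i ∈ s, (|F i ω| / A i) ^ (k * #s)) / #s) := by
    intro ω
    have := prod_le_sum_pow_card_div hs (y := fun i => (|F i ω| / A i) ^ k)
      (fun i => by have := hA i; positivity)
    simp only [← pow_mul] at this
    rw [prod_pow, prod_div_distrib, div_pow, ← abs_prod, div_le_iff₀ hP, mul_comm] at this
    exact this
  unfold MomentLE
  calc ∑ ω, |∏ i ∈ s, F i ω| ^ k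
      ≤ ∑ ω, (∏ i ∈ s, A i) ^ k * ((∑ i ∈ s, (|F i ω| / A i) ^ (k * #s)) / #s) :=
        sum_le_sum fun ω _ => key ω
    _ = (∏ i ∈ s, A i) ^ k *
          ((∑ i ∈ s, (∑ ω, |F i ω| ^ (k * #s)) / A i ^ (k * #s)) / #s) := by
        rw [← mul_sum, ← sum_div, sum_comm]
        simp only [div_pow, sum_div]
    _ ≤ (∏ i ∈ s, A i) ^ k * ((∑ _i ∈ s, (Fintype.card Ω : ℝ)) / #s) := by
        gcongr with i hi
        have := hA i
        rw [div_le_iff₀ (by positivity), mul_comm (Fintype.card Ω : ℝ)]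
        exact h i hi
    _ = _ := by
        rw [sum_const, nsmul_eq_mul, mul_div_cancel_left₀ _ hc.ne']

theorem MomentLE.mul {k : ℕ} {F G : Ω → ℝ} {A B : ℝ} (hA : 0 < A) (hB : 0 < B)
    (hF : MomentLE (2 * k) F A) (hG : MomentLE (2 * k) G B) :
    MomentLE k (fun ω => F ω * G ω) (A * B) := by
  have := MomentLE.prod (k := k) (s := (univ : Finset (Fin 2))) (F := ![F, G]) (A := ![A, B])
    (fun i => by fin_cases i <;> simpa) (fun i _ => by
      fin_cases i <;> simpa [mul_comm k])
  simpa using this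

theorem MomentLE.add {k : ℕ} {F G : Ω → ℝ} {A : ℝ} (hk : 1 ≤ k)
    (hF : MomentLE k F A) (hG : MomentLE k G A) :
    MomentLE k (fun ω => F ω + G ω) (2 * A) := by
  have := MomentLE.sum (s := (univ : Finset (Fin 2))) (F := ![F, G]) hk
    (fun i _ => by fin_cases i <;> simpa)
  simpa using this

end Moments

/-! ### Digit flips and the Littlewood–Paley inequality -/

section LittlewoodPaley

theorem succ_mul_mul_pow_le {a b : ℝ} (ha : 0 ≤ a) (hb : 0 ≤ b) (k : ℕ) :
    (k + 1) * (a * b ^ k) ≤ a ^ (k + 1) + k * b ^ (k + 1) := by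
  induction k with
  | zero => simp
  | succ k ih =>
    have h : 0 ≤ (a - b) * (a ^ (k + 1) - b ^ (k + 1)) := by
      rcases le_total a b with hab | hab
      · exact mul_nonneg_of_nonpos_of_nonpos (by linarith)
          (sub_nonpos.2 (pow_le_pow_left₀ ha hab _))
      · exact mul_nonneg (by linarith) (sub_nonneg.2 (pow_le_pow_left₀ hb hab _))
    have h2 := mul_le_mul_of_nonneg_left ih hb
    push_cast
    calc ((k : ℝ) + 1 + 1) * (a * b ^ (k + 1)) = b * ((k + 1) * (a * b ^ k)) + a * b ^ (k + 1) := by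
          ring
      _ ≤ b * (a ^ (k + 1) + k * b ^ (k + 1)) + a * b ^ (k + 1)
          + (a - b) * (a ^ (k + 1) - b ^ (k + 1)) := by linarith
      _ = _ := by ring

/-- The graph of an even power lies above its tangents. -/
theorem even_pow_tangent_le (u x : ℝ) (l : ℕ) :
    u ^ (2 * (l + 1)) + (2 * (l + 1)) * u ^ (2 * l + 1) * (x - u) ≤ x ^ (2 * (l + 1)) := by
  have h := succ_mul_mul_pow_le (abs_nonneg x) (abs_nonneg u) (2 * l + 1)
  have e1 : |x| ^ (2 * l + 1 + 1) = x ^ (2 * (l + 1)) := by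
    rw [show 2 * l + 1 + 1 = 2 * (l + 1) by ring, pow_mul, pow_mul, sq_abs]
  have e2 : |u| ^ (2 * l + 1 + 1) = u ^ (2 * (l + 1)) := by
    rw [show 2 * l + 1 + 1 = 2 * (l + 1) by ring, pow_mul, pow_mul, sq_abs]
  have e3 : x * u ^ (2 * l + 1) ≤ |x| * |u| ^ (2 * l + 1) := by
    rw [← abs_pow, ← abs_mul]
    exact le_abs_self _
  rw [e1, e2] at h
  push_cast at h
  have e4 : u ^ (2 * l + 1) * u = u ^ (2 * (l + 1)) := by ring
  nlinarith [h, e3, e4]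

theorem even_pow_le_avg (x d : ℝ) (l : ℕ) :
    2 * x ^ (2 * l) ≤ (x + d) ^ (2 * l) + (x - d) ^ (2 * l) := by
  cases l with
  | zero => norm_num
  | succ l =>
    have h1 := even_pow_tangent_le x (x + d) l
    have h2 := even_pow_tangent_le x (x - d) l
    linarith

/-- Tangents at `x + d` and `x - d`, evaluated at `x`, leave the error `2(l+1) d (u^(2l+1) -
w^(2l+1))` with `u - w = 2d`. The geometric sum extracts a second factor `d`. -/
theorem even_pow_avg_le (x d : ℝ) (l : ℕ) :
    (x + d) ^ (2 * (l + 1)) + (x - d) ^ (2 * (l + 1)) ≤ 2 * x ^ (2 * (l + 1)) +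
      8 * (l + 1) ^ 2 * (d ^ 2 * ((x + d) ^ (2 * l) + (x - d) ^ (2 * l))) := by
  have h1 := even_pow_tangent_le (x + d) x l
  have h2 := even_pow_tangent_le (x - d) x l
  generalize hu : x + d = u at *
  generalize hw : x - d = w at *
  have hd : u - w = 2 * d := by linarith
  have hg := geom_sum₂_mul u w (2 * l + 1)
  have hb : ∑ i ∈ range (2 * l + 1), u ^ i * w ^ (2 * l + 1 - 1 - i) ≤
      (2 * l + 1) * (u ^ (2 * l) + w ^ (2 * l)) := by
    calc _ ≤ ∑ i ∈ range (2 * l + 1), (u ^ (2 * l) + w ^ (2 * l)) := by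
          refine sum_le_sum fun i hi => ?_
          have hi' : i ≤ 2 * l := by have := mem_range.1 hi; omega
          refine (le_abs_self _).trans ?_
          rw [abs_mul, abs_pow, abs_pow]
          have hM : max |u| |w| ^ (2 * l) ≤ u ^ (2 * l) + w ^ (2 * l) := by
            have a1 : |u| ^ (2 * l) = u ^ (2 * l) := by rw [pow_mul, pow_mul, sq_abs]
            have a2 : |w| ^ (2 * l) = w ^ (2 * l) := by rw [pow_mul, pow_mul, sq_abs]
            rw [← a1, ← a2]
            rcases max_cases |u| |w| with h | h <;> rw [h.1]
            · exact le_add_of_nonneg_right (by positivity)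
            · exact le_add_of_nonneg_left (by positivity)
          calc |u| ^ i * |w| ^ (2 * l + 1 - 1 - i)
              ≤ max |u| |w| ^ i * max |u| |w| ^ (2 * l + 1 - 1 - i) := by
                gcongr
                · exact le_max_left _ _
                · exact le_max_right _ _
            _ = max |u| |w| ^ (2 * l) := by rw [← pow_add]; congr 1; omega
            _ ≤ _ := hM
      _ = _ := by simp [mul_add]
  have hP : 0 ≤ u ^ (2 * l) + w ^ (2 * l) := by
    have := (even_two_mul l).pow_nonneg u
    have := (even_two_mul l).pow_nonneg w
    linarith
  rw [hd] at hg
  have hx : x - u = -d := by linarith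
  have hx' : x - w = d := by linarith
  rw [hx] at h1
  rw [hx'] at h2
  have h3 : d * (u ^ (2 * l + 1) - w ^ (2 * l + 1)) ≤
      2 * d ^ 2 * ((2 * l + 1) * (u ^ (2 * l) + w ^ (2 * l))) := by
    rw [← hg]
    have := mul_le_mul_of_nonneg_left hb (by positivity : 0 ≤ 2 * d ^ 2)
    linarith
  have h4 : (2 * ((l : ℝ) + 1)) * (d * (u ^ (2 * l + 1) - w ^ (2 * l + 1))) ≤
      (2 * ((l : ℝ) + 1)) * (2 * d ^ 2 * ((2 * l + 2) * (u ^ (2 * l) + w ^ (2 * l)))) := by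
    refine mul_le_mul_of_nonneg_left (h3.trans ?_) (by positivity)
    gcongr
    norm_num
  linarith

variable {Ω : Type*}

/-- `p` is odd under the `c`-th flip and invariant under all later flips. -/
def IsLevel (τ : ℕ → Equiv.Perm Ω) (c : ℕ) (p : Ω → ℝ) : Prop :=
  (∀ ω, p (τ c ω) = -p ω) ∧ ∀ c', c < c' → ∀ ω, p (τ c' ω) = p ω

theorem IsLevel.zero (τ : ℕ → Equiv.Perm Ω) (c : ℕ) : IsLevel τ c (fun _ => 0) :=
  ⟨by simp, by simp⟩

theorem IsLevel.mul_lower {τ : ℕ → Equiv.Perm Ω} {c c' : ℕ} {p g : Ω → ℝ} (hp : IsLevel τ c p)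
    (hg : IsLevel τ c' g) (h : c' < c) : IsLevel τ c (fun ω => p ω * g ω) :=
  ⟨fun ω => by simp only [hp.1, hg.2 _ h, neg_mul], fun e he ω => by
    simp only [hp.2 _ he, hg.2 _ (h.trans he)]⟩

theorem IsLevel.mul_prod_lower {ι : Type*} {τ : ℕ → Equiv.Perm Ω} {c : ℕ} {p : Ω → ℝ}
    {s : Finset ι} {g : ι → Ω → ℝ} (hp : IsLevel τ c p)
    (hg : ∀ i ∈ s, ∃ c' < c, IsLevel τ c' (g i)) :
    IsLevel τ c (fun ω => p ω * ∏ i ∈ s, g i ω) := by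
  have h : ∀ e, c ≤ e → ∀ ω, ∏ i ∈ s, g i (τ e ω) = ∏ i ∈ s, g i ω := fun e he ω =>
    prod_congr rfl fun i hi => by
      obtain ⟨c', hc', hl⟩ := hg i hi
      exact hl.2 e (hc'.trans_le he) ω
  exact ⟨fun ω => by simp only [hp.1, h c le_rfl, neg_mul], fun e he ω => by
    simp only [hp.2 _ he, h e he.le]⟩

theorem IsLevel.sum {ι : Type*} {τ : ℕ → Equiv.Perm Ω} {c : ℕ} {s : Finset ι} {p : ι → Ω → ℝ}
    (hp : ∀ i ∈ s, IsLevel τ c (p i)) : IsLevel τ c (fun ω => ∑ i ∈ s, p i ω) :=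
  ⟨fun ω => by
    rw [← sum_neg_distrib]
    exact sum_congr rfl fun i hi => (hp i hi).1 ω, fun e he ω =>
    sum_congr rfl fun i hi => (hp i hi).2 e he ω⟩

variable [Fintype Ω]

/-- Peel off the term of highest level: its flip changes the sign of that term and fixes all the
others, so sums over `Ω` may be averaged over the sign. Then `even_pow_avg_le` bounds the new term,
and the convexity in `even_pow_le_avg` carries the old ones along. -/
theorem sum_even_pow_le_of_isLevel {ι : Type*} [DecidableEq ι] {τ : ℕ → Equiv.Perm Ω}
    {lev : ι → ℕ} {d : ι → Ω → ℝ} (l : ℕ) (s : Finset ι) (hinj : Set.InjOn lev s)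
    (hd : ∀ i ∈ s, IsLevel τ (lev i) (d i)) :
    ∑ ω, (∑ i ∈ s, d i ω) ^ (2 * (l + 1)) ≤
      8 * (l + 1) ^ 2 * ∑ ω, (∑ i ∈ s, d i ω ^ 2) * (∑ i ∈ s, d i ω) ^ (2 * l) := by
  induction s using Finset.induction_on_max_value lev with
  | empty => simp
  | insert a s ha hmax ih =>
    have ih := ih (hinj.mono (by simp)) fun i hi => hd i (mem_insert_of_mem hi)
    have hlt : ∀ i ∈ s, lev i < lev a := fun i hi => lt_of_le_of_ne (hmax i hi) fun h =>
      ha (hinj (by simp [hi]) (by simp) h ▸ hi)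
    have hinv : ∀ i ∈ s, ∀ ω, d i (τ (lev a) ω) = d i ω := fun i hi ω =>
      (hd i (mem_insert_of_mem hi)).2 _ (hlt i hi) ω
    have hodd := (hd a (mem_insert_self _ _)).1
    simp only [sum_insert ha]
    set F : Ω → ℝ := fun ω => ∑ i ∈ s, d i ω with hF
    set Q : Ω → ℝ := fun ω => ∑ i ∈ s, d i ω ^ 2 with hQ
    have hFi : ∀ ω, F (τ (lev a) ω) = F ω := fun ω => sum_congr rfl fun i hi => hinv i hi ω
    have hQi : ∀ ω, Q (τ (lev a) ω) = Q ω := fun ω =>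
      sum_congr rfl fun i hi => by rw [hinv i hi ω]
    have hQ0 : ∀ ω, 0 ≤ Q ω := fun ω => sum_nonneg fun i _ => sq_nonneg _
    have hsym : ∀ Φ : ℝ → ℝ → ℝ → ℝ,
        2 * ∑ ω, Φ (F ω) (d a ω) (Q ω) =
          ∑ ω, (Φ (F ω) (d a ω) (Q ω) + Φ (F ω) (-d a ω) (Q ω)) := by
      intro Φ
      have := Equiv.sum_comp (τ (lev a)) fun ω => Φ (F ω) (d a ω) (Q ω)
      simp only [hFi, hQi, hodd] at this
      rw [sum_add_distrib, this]
      ring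
    have s1 := hsym fun F D _ => (D + F) ^ (2 * (l + 1))
    have s2 := hsym fun F D Q => (D ^ 2 + Q) * (D + F) ^ (2 * l)
    have s3 : ∑ ω, ((d a ω + F ω) ^ (2 * (l + 1)) + (-d a ω + F ω) ^ (2 * (l + 1))) ≤
        2 * ∑ ω, F ω ^ (2 * (l + 1)) + 8 * (l + 1) ^ 2 * ∑ ω, d a ω ^ 2 *
          ((d a ω + F ω) ^ (2 * l) + (-d a ω + F ω) ^ (2 * l)) := by
      rw [mul_sum, mul_sum, ← sum_add_distrib]
      refine sum_le_sum fun ω _ => ?_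
      have := even_pow_avg_le (F ω) (d a ω) l
      rwa [sub_eq_add_neg, add_comm (F ω) (d a ω), add_comm (F ω) (-d a ω)] at this
    have s4 : 2 * ∑ ω, Q ω * F ω ^ (2 * l) ≤
        ∑ ω, Q ω * ((d a ω + F ω) ^ (2 * l) + (-d a ω + F ω) ^ (2 * l)) := by
      rw [mul_sum]
      refine sum_le_sum fun ω _ => ?_
      have := even_pow_le_avg (F ω) (d a ω) l
      rw [sub_eq_add_neg, add_comm (F ω) (d a ω), add_comm (F ω) (-d a ω)] at this
      have := mul_le_mul_of_nonneg_left this (hQ0 ω)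
      linarith
    have s5 : ∑ ω, ((d a ω ^ 2 + Q ω) * (d a ω + F ω) ^ (2 * l) +
          ((-d a ω) ^ 2 + Q ω) * (-d a ω + F ω) ^ (2 * l)) =
        ∑ ω, d a ω ^ 2 * ((d a ω + F ω) ^ (2 * l) + (-d a ω + F ω) ^ (2 * l)) +
        ∑ ω, Q ω * ((d a ω + F ω) ^ (2 * l) + (-d a ω + F ω) ^ (2 * l)) := by
      rw [← sum_add_distrib]
      refine sum_congr rfl fun ω _ => by ring
    have s6 := mul_le_mul_of_nonneg_left s4 (by positivity : 0 ≤ 8 * ((l : ℝ) + 1) ^ 2)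
    have s7 : (8 * ((l : ℝ) + 1) ^ 2) * (2 * ∑ ω, (d a ω ^ 2 + Q ω) * (d a ω + F ω) ^ (2 * l)) =
      (8 * ((l : ℝ) + 1) ^ 2) * (∑ ω, d a ω ^ 2 * ((d a ω + F ω) ^ (2 * l) +
        (-d a ω + F ω) ^ (2 * l)) + ∑ ω, Q ω * ((d a ω + F ω) ^ (2 * l) +
        (-d a ω + F ω) ^ (2 * l))) := by rw [s2, s5]
    linarith

/-- The Littlewood–Paley inequality for dyadic martingales, with linear growth of the constant. -/
theorem MomentLE.of_square {ι : Type*} {τ : ℕ → Equiv.Perm Ω}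
    {lev : ι → ℕ} {d : ι → Ω → ℝ} {m : ℕ} (hm : 1 ≤ m) {s : Finset ι} (hinj : Set.InjOn lev s)
    (hd : ∀ i ∈ s, IsLevel τ (lev i) (d i)) {R : ℝ}
    (hS : MomentLE m (fun ω => ∑ i ∈ s, d i ω ^ 2) (R ^ 2)) :
    MomentLE (2 * m) (fun ω => ∑ i ∈ s, d i ω) (3 * m * R) := by
  classical
  obtain ⟨l, rfl⟩ : ∃ l, m = l + 1 := ⟨m - 1, by omega⟩
  have h := sum_even_pow_le_of_isLevel l s hinj hd
  set F : Ω → ℝ := fun ω => ∑ i ∈ s, d i ω with hF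
  set Q : Ω → ℝ := fun ω => ∑ i ∈ s, d i ω ^ 2 with hQ
  have hQ0 : ∀ ω, 0 ≤ Q ω := fun ω => sum_nonneg fun i _ => sq_nonneg _
  -- Young's inequality separates the square function from `F`; the resulting `l * F ω ^ (2 * (l +
  -- 1))` is absorbed by the left-hand side of `h3`.
  have key : ∀ ω, (l + 1) * (8 * (l + 1) ^ 2 * (Q ω * F ω ^ (2 * l))) ≤
      (8 * (l + 1) ^ 2 * Q ω) ^ (l + 1) + l * F ω ^ (2 * (l + 1)) := by
    intro ω
    have := succ_mul_mul_pow_le (a := 8 * (l + 1) ^ 2 * Q ω) (b := F ω ^ 2)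
      (by have := hQ0 ω; positivity) (by positivity) l
    rw [← pow_mul, ← pow_mul] at this
    linarith
  have h2 := sum_le_sum fun ω (_ : ω ∈ univ) => key ω
  rw [← mul_sum, ← mul_sum, sum_add_distrib, ← mul_sum] at h2
  have h3 : ((l : ℝ) + 1) * ∑ ω, F ω ^ (2 * (l + 1)) ≤ ((l : ℝ) + 1) *
      (8 * (l + 1) ^ 2 * ∑ ω, Q ω * F ω ^ (2 * l)) := by gcongr
  have h4 : ∑ ω, F ω ^ (2 * (l + 1)) ≤ ∑ ω, (8 * (l + 1) ^ 2 * Q ω) ^ (l + 1) := by linarith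
  unfold MomentLE at *
  calc ∑ ω, |F ω| ^ (2 * (l + 1)) = ∑ ω, F ω ^ (2 * (l + 1)) :=
        sum_congr rfl fun ω _ => by rw [pow_mul, pow_mul, sq_abs]
    _ ≤ _ := h4
    _ = (8 * (l + 1) ^ 2) ^ (l + 1) * ∑ ω, |Q ω| ^ (l + 1) := by
        rw [mul_sum]
        refine sum_congr rfl fun ω _ => by rw [mul_pow, abs_of_nonneg (hQ0 ω)]
    -- Replacing 8 by 9 makes the constant the perfect square of `3 * m`.
    _ ≤ (9 * (l + 1) ^ 2) ^ (l + 1) * ((R ^ 2) ^ (l + 1) * Fintype.card Ω) := by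
        gcongr
        norm_num
    _ = _ := by
        push_cast
        rw [pow_mul, ← mul_assoc, ← mul_pow]
        ring_nf

/-- For terms bounded by 1 the square function is at most the number of terms. Only nonzero terms
are constrained, because levels such as `n - a - b` use truncated subtraction and are meaningful
only on the support. -/
theorem MomentLE.of_isLevel {ι : Type*} [Fintype ι] {τ : ℕ → Equiv.Perm Ω}
    {lev : ι → ℕ} {d : ι → Ω → ℝ} {m : ℕ} (hm : 1 ≤ m)
    (hinj : ∀ i j, d i ≠ 0 → d j ≠ 0 → lev i = lev j → i = j)
    (hd : ∀ i, d i ≠ 0 → IsLevel τ (lev i) (d i)) (hb : ∀ i ω, |d i ω| ≤ 1) {R : ℝ}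
    (hR : (Fintype.card ι : ℝ) ≤ R ^ 2) :
    MomentLE (2 * m) (fun ω => ∑ i, d i ω) (3 * m * R) := by
  classical
  have hsum : (fun ω => ∑ i, d i ω) = fun ω => ∑ i with d i ≠ 0, d i ω := by
    funext ω
    refine (sum_filter_of_ne (p := fun i => d i ≠ 0) fun i _ hi h => hi ?_).symm
    rw [h, Pi.zero_apply]
  rw [hsum]
  refine MomentLE.of_square (lev := lev) hm
    (fun i hi j hj => hinj i j (by simpa using hi) (by simpa using hj))
    (fun i hi => hd i (by simpa using hi)) (MomentLE.of_abs_le fun ω => ?_)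
  rw [abs_of_nonneg (sum_nonneg fun _ _ => sq_nonneg _)]
  refine le_trans ?_ hR
  calc ∑ i with d i ≠ 0, d i ω ^ 2 ≤ ∑ i, d i ω ^ 2 :=
        sum_le_sum_of_subset_of_nonneg (filter_subset _ _) fun _ _ _ => sq_nonneg _
    _ ≤ ∑ _i : ι, (1 : ℝ) := sum_le_sum fun i hi => by
        rw [← sq_abs]
        exact pow_le_one₀ (abs_nonneg _) (hb i ω)
    _ = Fintype.card ι := by simp

end LittlewoodPaley

/-! ### Haar systems and square-root cancellation at a vertex -/

section Systems

variable {Ω W : Type*} {n : ℕ} {τ : Fin 3 → ℕ → Equiv.Perm Ω}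

/-- Functions `G j a b` that behave like r-functions with parameter `(n - a - b, a, b)`, whose
first parameter increases with the index `j`. -/
structure HaarSystem [LinearOrder W] (n : ℕ) (τ : Fin 3 → ℕ → Equiv.Perm Ω)
    (G : W → Fin (n + 1) → Fin (n + 1) → Ω → ℝ) : Prop where
  abs_le : ∀ j a b ω, |G j a b ω| ≤ 1
  level0 : ∀ j (a b : Fin (n + 1)), IsLevel (τ 0) (n - a - b) (G j a b)
  level1 : ∀ j (a b : Fin (n + 1)), IsLevel (τ 1) a (G j a b)
  level2 : ∀ j (a b : Fin (n + 1)), IsLevel (τ 2) b (G j a b)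
  le : ∀ {j a b}, G j a b ≠ 0 → (a : ℕ) + b ≤ n
  lt : ∀ {i j a b a' b'}, i < j → G i a b ≠ 0 → G j a' b' ≠ 0 → (a' : ℕ) + b' < (a : ℕ) + b

/-- The sum over all assignments of the second parameters, indexed by `A`, and of the third
parameters, indexed by `B`. -/
def freeSum {A B : Type*} [Fintype A] [Fintype B] [DecidableEq A] [DecidableEq B] [Fintype W]
    (G : W → Fin (n + 1) → Fin (n + 1) → Ω → ℝ) (κ : W → A) (l : W → B) (ω : Ω) : ℝ :=
  ∑ x : A → Fin (n + 1), ∑ y : B → Fin (n + 1), ∏ j, G j (x (κ j)) (y (l j)) ω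

theorem freeSum_swap {A B : Type*} [Fintype A] [Fintype B] [DecidableEq A] [DecidableEq B]
    [Fintype W] (G : W → Fin (n + 1) → Fin (n + 1) → Ω → ℝ) (κ : W → A) (l : W → B) :
    freeSum (fun j a b => G j b a) l κ = freeSum G κ l :=
  funext fun _ => sum_comm

variable [LinearOrder W] {G : W → Fin (n + 1) → Fin (n + 1) → Ω → ℝ}

theorem HaarSystem.swap (hG : HaarSystem n τ G) :
    HaarSystem n (fun k => τ (Equiv.swap 1 2 k)) (fun j a b => G j b a) where
  abs_le j a b := hG.abs_le j b a
  level0 j a b := by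
    have h := hG.level0 j b a
    rw [Nat.sub_right_comm] at h
    rwa [show Equiv.swap (1 : Fin 3) 2 0 = 0 by decide]
  level1 j a b := by
    rw [show Equiv.swap (1 : Fin 3) 2 1 = 2 by decide]
    exact hG.level2 j b a
  level2 j a b := by
    rw [show Equiv.swap (1 : Fin 3) 2 2 = 1 by decide]
    exact hG.level1 j b a
  le h := by rw [add_comm]; exact hG.le h
  lt hij h h' := by
    have := hG.lt hij h h'
    omega

/-- Each axiom either holds for the zero function or assumes that the functions are nonzero, so
masking is free. The colour constraints enter in this way. -/
theorem HaarSystem.restrict (hG : HaarSystem n τ G) (P : W → Fin (n + 1) → Fin (n + 1) → Prop)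
    [∀ j a b, Decidable (P j a b)] :
    HaarSystem n τ (fun j a b ω => if P j a b then G j a b ω else 0) := by
  have key : ∀ j a b, (fun ω => if P j a b then G j a b ω else 0) = G j a b ∨
      (fun ω => if P j a b then G j a b ω else 0) = fun _ => 0 := by
    intro j a b
    by_cases h : P j a b
    · exact Or.inl (by simp [h])
    · exact Or.inr (by simp [h])
  have ne : ∀ {j a b}, (fun ω => if P j a b then G j a b ω else 0) ≠ 0 → G j a b ≠ 0 := by
    intro j a b h h'
    refine h (funext fun ω => ?_)
    simp [h']
  constructor
  · intro j a b ω
    split_ifs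
    · exact hG.abs_le j a b ω
    · simp
  · intro j a b
    rcases key j a b with h | h <;> rw [h]
    exacts [hG.level0 j a b, IsLevel.zero _ _]
  · intro j a b
    rcases key j a b with h | h <;> rw [h]
    exacts [hG.level1 j a b, IsLevel.zero _ _]
  · intro j a b
    rcases key j a b with h | h <;> rw [h]
    exacts [hG.level2 j a b, IsLevel.zero _ _]
  · exact fun h => hG.le (ne h)
  · exact fun hij h h' => hG.lt hij (ne h) (ne h')

theorem HaarSystem.comp {W' : Type*} [LinearOrder W'] (hG : HaarSystem n τ G) {g : W' → W}
    (hg : StrictMono g) : HaarSystem n τ (fun j => G (g j)) where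
  abs_le _ := hG.abs_le _
  level0 _ := hG.level0 _
  level1 _ := hG.level1 _
  level2 _ := hG.level2 _
  le h := hG.le h
  lt hij h h' := hG.lt (hg hij) h h'

/-- The largest index of `s` has the strictly largest first parameter, so it alone determines the
level of the product in the first variable. That level is `n - x k - b`, and different `b` give
different levels. -/
theorem HaarSystem.column [Fintype Ω] (hG : HaarSystem n τ G) {s : Finset W} (hs : s.Nonempty)
    (x : W → Fin (n + 1)) {m : ℕ} (hm : 1 ≤ m) {R : ℝ} (hR : (n + 1 : ℝ) ≤ R ^ 2) :
    MomentLE (2 * m) (fun ω => ∑ b, ∏ j ∈ s, G j (x j) b ω) (3 * m * R) := by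
  set k := s.max' hs with hk
  have hks : k ∈ s := s.max'_mem hs
  have hfac : ∀ b, (fun ω => ∏ j ∈ s, G j (x j) b ω) ≠ 0 → ∀ j ∈ s, G j (x j) b ≠ 0 := by
    intro b h j hj h0
    exact h (funext fun ω => prod_eq_zero hj (by rw [h0]; rfl))
  refine MomentLE.of_isLevel (τ := τ 0) (lev := fun b : Fin (n + 1) => n - x k - b)
    (d := fun b ω => ∏ j ∈ s, G j (x j) b ω) hm ?_ ?_ ?_ (by simpa using hR)
  · intro b b' hb hb' h
    have h1 := hG.le (hfac b hb k hks)
    have h2 := hG.le (hfac b' hb' k hks)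
    apply Fin.ext
    omega
  · intro b hb
    have : (fun ω => ∏ j ∈ s, G j (x j) b ω) =
        fun ω => G k (x k) b ω * ∏ j ∈ s.erase k, G j (x j) b ω :=
      funext fun ω => (mul_prod_erase s _ hks).symm
    rw [this]
    refine (hG.level0 k (x k) b).mul_prod_lower fun j hj => ⟨n - x j - b, ?_, hG.level0 _ _ _⟩
    have hj' := mem_of_mem_erase hj
    have hlt : j < k := lt_of_le_of_ne (s.le_max' j hj') (ne_of_mem_erase hj)
    have h1 := hG.lt hlt (hfac b hb j hj') (hfac b hb k hks)
    have h2 := hG.le (hfac b hb j hj')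
    omega
  · intro b ω
    rw [abs_prod]
    exact prod_le_one (fun _ _ => abs_nonneg _) fun j _ => hG.abs_le _ _ _ _

variable {A B : Type*} [Fintype A] [Fintype B] [DecidableEq A] [DecidableEq B] [Fintype W]
  [Fintype Ω] {κ : W → A} {l : W → B}

/-- Once `x` is fixed, the sum over `y` factors into columns, one for each `β`. Hölder over the
columns multiplies the moment order by `Fintype.card B`; the sum over `x` is estimated trivially. -/
theorem HaarSystem.freeSum_columns [Nonempty W] (hG : HaarSystem n τ G)
    (hl : Function.Surjective l) {m : ℕ} (hm : 1 ≤ m) {R : ℝ} (hR0 : 0 < R)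
    (hR : (n + 1 : ℝ) ≤ R ^ 2) :
    MomentLE (2 * m) (freeSum G κ l) ((n + 1 : ℝ) ^ Fintype.card A *
      (3 * (m * Fintype.card B : ℕ) * R) ^ Fintype.card B) := by
  have : Nonempty B := Nonempty.map l inferInstance
  have hmB : 1 ≤ m * Fintype.card B := Nat.mul_pos hm Fintype.card_pos
  have hpos : (0 : ℝ) < 3 * (m * Fintype.card B : ℕ) * R := by
    have : (0 : ℝ) < (m * Fintype.card B : ℕ) := by exact_mod_cast hmB
    positivity
  have hfac : freeSum G κ l = fun ω => ∑ x ∈ (univ : Finset (A → Fin (n + 1))),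
      ∏ β ∈ (univ : Finset B), ∑ b, ∏ j with l j = β, G j (x (κ j)) b ω := by
    funext ω
    refine sum_congr rfl fun x _ => ?_
    rw [prod_univ_sum, Fintype.piFinset_univ]
    refine sum_congr rfl fun y _ => ?_
    rw [← prod_fiberwise univ l]
    refine prod_congr rfl fun β _ => prod_congr rfl fun j hj => ?_
    rw [(mem_filter.1 hj).2]
  rw [hfac]
  have hcard : ((n + 1 : ℝ) ^ Fintype.card A) = (#(univ : Finset (A → Fin (n + 1))) : ℝ) := by
    simp
  have hB : (3 * (m * Fintype.card B : ℕ) * R) ^ Fintype.card B =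
      ∏ _β ∈ (univ : Finset B), (3 * (m * Fintype.card B : ℕ) * R) := by simp
  rw [hcard, hB]
  refine MomentLE.sum (by omega) fun x _ => MomentLE.prod (fun _ => hpos) fun β _ => ?_
  rw [card_univ, mul_assoc]
  obtain ⟨j, hj⟩ := hl β
  exact hG.column ⟨j, by simp [hj]⟩ (fun j => x (κ j)) hmB hR

end Systems

/-! ### The Beck gain for two edges with a common parameter -/

section Pairs

variable {Ω W : Type*} [Fintype Ω] {n : ℕ}

/-- Expand the square function in `c` into pairs `(a, a')`. With `N = n + 1 = t ^ 16`, the diagonal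
contributes about `N * N * M^2`, and the off-diagonal, where `hX` saves a square root, about `N^2 *
N^(1/2) * M^2`. The root of the larger is `M * t ^ 20`, against the trivial `M * t ^ 32`. -/
theorem MomentLE.of_bilinear {τ : ℕ → Equiv.Perm Ω} {h : Fin (n + 1) → Fin (n + 1) → Ω → ℝ}
    {Φ : Fin (n + 1) → Ω → ℝ} {m : ℕ} (hm : 1 ≤ m) {t M : ℝ} (ht : 1 ≤ t)
    (htn : t ^ 16 = n + 1) (hM : 0 < M)
    (hD : ∀ c : Fin (n + 1), IsLevel τ c (fun ω => ∑ a, h c a ω * Φ a ω)) (hh : ∀ c a ω, |h c a ω| ≤ 1)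
    (hX : ∀ a a', a ≠ a' → MomentLE (2 * m) (fun ω => ∑ c, h c a ω * h c a' ω) (3 * m * t ^ 8))
    (hΦ : ∀ a, MomentLE (2 * (2 * m)) (Φ a) M) :
    MomentLE (2 * m) (fun ω => ∑ c, ∑ a, h c a ω * Φ a ω) (9 * m ^ 2 * M * t ^ 20) := by
  have hm' : (1 : ℝ) ≤ m := by exact_mod_cast hm
  have ht0 : 0 < t := by linarith
  have hsq : (fun ω => ∑ c : Fin (n + 1), (∑ a, h c a ω * Φ a ω) ^ 2) = fun ω =>
      ∑ p ∈ (univ : Finset (Fin (n + 1))).diag,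
        (Φ p.1 ω * Φ p.2 ω) * ∑ c, h c p.1 ω * h c p.2 ω +
      ∑ p ∈ (univ : Finset (Fin (n + 1))).offDiag,
        (Φ p.1 ω * Φ p.2 ω) * ∑ c, h c p.1 ω * h c p.2 ω := by
    funext ω
    rw [← sum_union (disjoint_diag_offDiag _), diag_union_offDiag, sum_product]
    simp only [sq, sum_mul_sum]
    simp only [mul_sum]
    rw [sum_comm]
    refine sum_congr rfl fun a _ => ?_
    rw [sum_comm]
    refine sum_congr rfl fun a' _ => sum_congr rfl fun c _ => by ring
  have hR : MomentLE m (fun ω => ∑ c : Fin (n + 1), (∑ a, h c a ω * Φ a ω) ^ 2)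
      ((3 * m * M * t ^ 20) ^ 2) := by
    rw [hsq]
    have h2 : MomentLE m (fun ω =>
      ∑ p ∈ (univ : Finset (Fin (n + 1))).diag,
        (Φ p.1 ω * Φ p.2 ω) * ∑ c, h c p.1 ω * h c p.2 ω +
      ∑ p ∈ (univ : Finset (Fin (n + 1))).offDiag,
        (Φ p.1 ω * Φ p.2 ω) * ∑ c, h c p.1 ω * h c p.2 ω) (2 * (3 * m * M ^ 2 * t ^ 40)) := by
      refine MomentLE.add hm ?_ ?_
      · refine (MomentLE.sum (A := (M * M) * t ^ 16) hm fun p hp => ?_).mono (by positivity) ?_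
        · refine MomentLE.mul (by positivity) (by positivity) (MomentLE.mul hM hM (hΦ _) (hΦ _))
            (MomentLE.of_abs_le fun ω => ?_)
          rw [htn]
          calc |∑ c, h c p.1 ω * h c p.2 ω| ≤ ∑ c, |h c p.1 ω * h c p.2 ω| :=
                abs_sum_le_sum_abs _ _
            _ ≤ ∑ _c : Fin (n + 1), (1 : ℝ) := sum_le_sum fun c _ => by
                rw [abs_mul]
                exact mul_le_one₀ (hh _ _ _) (abs_nonneg _) (hh _ _ _)
            _ = _ := by simp
        · rw [diag_card, card_univ, Fintype.card_fin]
          push_cast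
          rw [← htn]
          calc t ^ 16 * (M * M * t ^ 16) = M ^ 2 * t ^ 32 := by ring
            _ ≤ (3 * m * M ^ 2) * t ^ 40 := by
              gcongr
              · nlinarith [sq_nonneg M]
              · norm_num
      · refine (MomentLE.sum (A := (M * M) * (3 * m * t ^ 8)) hm fun p hp => ?_).mono
          (by positivity) ?_
        · exact MomentLE.mul (by positivity) (by positivity) (MomentLE.mul hM hM (hΦ _) (hΦ _))
            (hX _ _ (mem_offDiag.1 hp).2.2)
        · have hc : (#(univ : Finset (Fin (n + 1))).offDiag : ℝ) ≤ t ^ 16 * t ^ 16 := by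
            rw [offDiag_card, card_univ, Fintype.card_fin, htn]
            exact_mod_cast Nat.sub_le _ _
          calc _ ≤ (t ^ 16 * t ^ 16) * (M * M * (3 * m * t ^ 8)) := by gcongr
            _ = _ := by ring
    refine h2.mono (by positivity) ?_
    calc 2 * (3 * m * M ^ 2 * t ^ 40) = (6 * m) * (M ^ 2 * t ^ 40) := by ring
      _ ≤ (9 * m ^ 2) * (M ^ 2 * t ^ 40) := mul_le_mul_of_nonneg_right (by nlinarith) (by positivity)
      _ = _ := by ring
  have := MomentLE.of_square (τ := τ) (lev := fun c : Fin (n + 1) => (c : ℕ)) (s := univ) hm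
    (fun _ _ _ _ h => Fin.ext h) (fun c _ => hD c) hR
  convert this using 1
  ring

variable {τ : Fin 3 → ℕ → Equiv.Perm Ω} [LinearOrder W]
  {G : W → Fin (n + 1) → Fin (n + 1) → Ω → ℝ}

/-- Since `a` is shared and `i < j` forces `b' < b`, the level of the product in the third variable
is `b`. The off-diagonal products have distinct first parameters, so the first variable supplies
their cancellation. -/
theorem HaarSystem.pair_of_lt (hG : HaarSystem n τ G) {i j : W} (hij : i < j)
    (T : Finset (Fin (n + 1))) {m : ℕ} (hm : 1 ≤ m) {t M : ℝ} (ht : 1 ≤ t)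
    (htn : t ^ 16 = n + 1) (hM : 0 < M)
    (hΦ : ∀ a, MomentLE (2 * (2 * m)) (fun ω => ∑ b ∈ T, G j a b ω) M) :
    MomentLE (2 * m) (fun ω => ∑ a, ∑ b, G i a b ω * ∑ b' ∈ T, G j a b' ω)
      (9 * m ^ 2 * M * t ^ 20) := by
  have hre : (fun ω => ∑ a, ∑ b, G i a b ω * ∑ b' ∈ T, G j a b' ω) =
      fun ω => ∑ b, ∑ a, G i a b ω * ∑ b' ∈ T, G j a b' ω := funext fun ω => sum_comm
  rw [hre]
  refine MomentLE.of_bilinear (τ := τ 2) (h := fun b a => G i a b) hm ht htn hM ?_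
    (fun c a ω => hG.abs_le _ _ _ _) ?_ hΦ
  · intro b
    refine IsLevel.sum fun a _ => ?_
    simp only [mul_sum]
    refine IsLevel.sum fun b' _ => ?_
    by_cases h1 : G i a b = 0
    · simpa [h1] using IsLevel.zero (τ 2) b
    by_cases h2 : G j a b' = 0
    · simpa [h2] using IsLevel.zero (τ 2) b
    have := hG.lt hij h1 h2
    exact (hG.level2 i a b).mul_lower (hG.level2 j a b') (by omega)
  · have key : ∀ a a' : Fin (n + 1), a < a' →
        MomentLE (2 * m) (fun ω => ∑ c, G i a c ω * G i a' c ω) (3 * m * t ^ 8) := by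
      intro a a' haa
      have hle : ∀ c, (fun ω => G i a c ω * G i a' c ω) ≠ 0 → (a' : ℕ) + c ≤ n := by
        intro c hc
        refine hG.le (j := i) fun h => hc (funext fun ω => ?_)
        simp [h]
      refine MomentLE.of_isLevel (τ := τ 0) (lev := fun c : Fin (n + 1) => n - a - c)
        (d := fun c ω => G i a c ω * G i a' c ω) hm ?_ ?_ ?_ ?_
      · intro c c' hc hc' h
        have h1 := hle c hc
        have h2 := hle c' hc'
        apply Fin.ext
        omega
      · intro c hc
        have h1 := hle c hc
        exact (hG.level0 i a c).mul_lower (hG.level0 i a' c) (by omega)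
      · intro c ω
        rw [abs_mul]
        exact mul_le_one₀ (hG.abs_le _ _ _ _) (abs_nonneg _) (hG.abs_le _ _ _ _)
      · rw [← pow_mul, htn]
        simp
    intro a a' haa
    rcases lt_or_gt_of_ne haa with h | h
    · exact key a a' h
    · simpa only [mul_comm] using key a' a h

/-- The reflection `b ↦ n - a - b`, truncated. -/
def reflect (a b : Fin (n + 1)) : Fin (n + 1) := ⟨n - a - b, by omega⟩

theorem sum_reflect {a : Fin (n + 1)} {F : Fin (n + 1) → ℝ}
    (hF : ∀ b, F b ≠ 0 → (a : ℕ) + b ≤ n) :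
    ∑ b, F b = ∑ c : Fin (n + 1), if (a : ℕ) + c ≤ n then F (reflect a c) else 0 := by
  rw [← sum_filter, ← sum_filter_of_ne (p := fun b : Fin (n + 1) => (a : ℕ) + b ≤ n)
    fun b _ h => hF b h]
  refine sum_nbij' (reflect a) (reflect a) ?_ ?_ ?_ ?_ ?_
  · intro b hb
    simp only [mem_filter, mem_univ, true_and, reflect] at *
    omega
  · intro b hb
    simp only [mem_filter, mem_univ, true_and, reflect] at *
    omega
  · intro b hb
    simp only [mem_filter, mem_univ, true_and, reflect, Fin.ext_iff] at *
    omega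
  · intro b hb
    simp only [mem_filter, mem_univ, true_and, reflect, Fin.ext_iff] at *
    omega
  · intro b hb
    congr 1
    simp only [mem_filter, mem_univ, true_and, reflect, Fin.ext_iff] at *
    omega

/-- Here edge `i` has the smaller third parameter but the larger first one. Summing over the first
parameter `c = n - a - b` in place of `b` exchanges the roles of the first and third variables in
`HaarSystem.pair_of_lt`. -/
theorem HaarSystem.pair_of_gt (hG : HaarSystem n τ G) {i j : W} (hij : j < i)
    (T : Finset (Fin (n + 1))) {m : ℕ} (hm : 1 ≤ m) {t M : ℝ} (ht : 1 ≤ t)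
    (htn : t ^ 16 = n + 1) (hM : 0 < M)
    (hΦ : ∀ a, MomentLE (2 * (2 * m)) (fun ω => ∑ b ∈ T, G j a b ω) M) :
    MomentLE (2 * m) (fun ω => ∑ a, ∑ b, G i a b ω * ∑ b' ∈ T, G j a b' ω)
      (9 * m ^ 2 * M * t ^ 20) := by
  set h : Fin (n + 1) → Fin (n + 1) → Ω → ℝ := fun c a =>
    if (a : ℕ) + c ≤ n then G i a (reflect a c) else 0 with hh
  have hle : ∀ {c a}, h c a ≠ 0 → (a : ℕ) + c ≤ n := by
    intro c a hca
    by_contra hn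
    exact hca (if_neg hn)
  have heq : ∀ {c a}, h c a ≠ 0 → h c a = G i a (reflect a c) := fun hca => if_pos (hle hca)
  have hb : ∀ c a ω, |h c a ω| ≤ 1 := by
    intro c a ω
    simp only [hh]
    split_ifs
    · exact hG.abs_le _ _ _ _
    · simp
  have hre : (fun ω => ∑ a, ∑ b, G i a b ω * ∑ b' ∈ T, G j a b' ω) =
      fun ω => ∑ c, ∑ a, h c a ω * ∑ b' ∈ T, G j a b' ω := by
    funext ω
    rw [sum_comm (f := fun c a => h c a ω * ∑ b' ∈ T, G j a b' ω)]
    refine sum_congr rfl fun a _ => ?_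
    rw [← sum_mul, ← sum_mul, sum_reflect (a := a) (F := fun b => G i a b ω)]
    · congr 1
      refine sum_congr rfl fun c _ => ?_
      simp only [hh]
      split_ifs <;> rfl
    · intro b hb
      exact hG.le (j := i) fun h0 => hb (by rw [h0]; rfl)
  rw [hre]
  refine MomentLE.of_bilinear (τ := τ 0) hm ht htn hM ?_ hb ?_ hΦ
  · intro c
    refine IsLevel.sum fun a _ => ?_
    simp only [mul_sum]
    refine IsLevel.sum fun b' _ => ?_
    by_cases h1 : h c a = 0
    · simpa [h1] using IsLevel.zero (τ 0) c
    by_cases h2 : G j a b' = 0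
    · simpa [h2] using IsLevel.zero (τ 0) c
    have h3 := hle h1
    have h4 := hG.le h2
    have h5 := hG.level0 i a (reflect a c)
    have h7 := heq h1
    rw [h7] at h1 ⊢
    have h6 := hG.lt hij h2 h1
    simp only [reflect] at h5 h6
    rw [show n - (a : ℕ) - (n - a - c) = c by omega] at h5
    exact h5.mul_lower (hG.level0 j a b') (by omega)
  · have key : ∀ a a' : Fin (n + 1), a < a' →
        MomentLE (2 * m) (fun ω => ∑ c, h c a ω * h c a' ω) (3 * m * t ^ 8) := by
      intro a a' haa
      have hne : ∀ c, (fun ω => h c a ω * h c a' ω) ≠ 0 → h c a ≠ 0 ∧ h c a' ≠ 0 := by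
        intro c hc
        constructor <;> exact fun h => hc (funext fun ω => by simp [h])
      refine MomentLE.of_isLevel (τ := τ 2) (lev := fun c : Fin (n + 1) => n - a - c)
        (d := fun c ω => h c a ω * h c a' ω) hm ?_ ?_ ?_ ?_
      · intro c c' hc hc' h
        have h1 := hle (hne c hc).2
        have h2 := hle (hne c' hc').2
        apply Fin.ext
        omega
      · intro c hc
        have h1 := hle (hne c hc).2
        rw [heq (hne c hc).1, heq (hne c hc).2]
        exact (hG.level2 i a (reflect a c)).mul_lower (hG.level2 i a' (reflect a' c))
          (by simp only [reflect]; omega)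
      · intro c ω
        rw [abs_mul]
        exact mul_le_one₀ (hb _ _ _) (abs_nonneg _) (hb _ _ _)
      · rw [← pow_mul, htn]
        simp
    intro a a' haa
    rcases lt_or_gt_of_ne haa with h | h
    · exact key a a' h
    · simpa only [mul_comm] using key a' a h

theorem HaarSystem.pair (hG : HaarSystem n τ G) {i j : W} (hij : i ≠ j)
    (T : Finset (Fin (n + 1))) {m : ℕ} (hm : 1 ≤ m) {t M : ℝ} (ht : 1 ≤ t)
    (htn : t ^ 16 = n + 1) (hM : 0 < M)
    (hΦ : ∀ a, MomentLE (2 * (2 * m)) (fun ω => ∑ b ∈ T, G j a b ω) M) :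
    MomentLE (2 * m) (fun ω => ∑ a, ∑ b, G i a b ω * ∑ b' ∈ T, G j a b' ω)
      (9 * m ^ 2 * M * t ^ 20) := by
  rcases lt_or_gt_of_ne hij with h | h
  · exact hG.pair_of_lt h T hm ht htn hM hΦ
  · exact hG.pair_of_gt h T hm ht htn hM hΦ

end Pairs

/-! ### Connected graphs -/

section Connected

theorem sum_fun_unique {A T M : Type*} [Fintype A] [DecidableEq A] [Fintype T] [AddCommMonoid M]
    {α : A} (h : ∀ β, β = α) (F : T → M) : ∑ x : A → T, F (x α) = ∑ a, F a :=
  Fintype.sum_bijective (fun x : A → T => x α)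
    ⟨fun x y hxy => funext fun β => by rw [h β]; exact hxy, fun a => ⟨fun _ => a, rfl⟩⟩ _ _
    fun _ => rfl

theorem sum_fun_pair {A T M : Type*} [Fintype A] [DecidableEq A] [Fintype T] [AddCommMonoid M]
    {α β : A} (hne : α ≠ β) (h : ∀ γ, γ = α ∨ γ = β) (F : T → T → M) :
    ∑ x : A → T, F (x α) (x β) = ∑ a, ∑ b, F a b := by
  rw [← Fintype.sum_prod_type']
  refine Fintype.sum_bijective (fun x : A → T => (x α, x β)) ⟨fun x y hxy => ?_, fun p => ?_⟩ _ _
    fun _ => rfl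
  · have h1 : x α = y α := congrArg Prod.fst hxy
    have h2 : x β = y β := congrArg Prod.snd hxy
    funext γ
    rcases h γ with rfl | rfl <;> assumption
  · exact ⟨fun γ => if γ = α then p.1 else p.2, by simp [hne.symm]⟩

theorem not_forall_eq_of_surjective {W C : Type*} [Fintype C] {f : W → C}
    (hf : Function.Surjective f) (hC : Fintype.card C = 2) (c : C) : ¬ ∀ j, f j = c := by
  intro h
  have : Fintype.card C ≤ 1 := Fintype.card_le_one_iff.2 fun a b => by
    obtain ⟨a, rfl⟩ := hf a
    obtain ⟨b, rfl⟩ := hf b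
    rw [h a, h b]
  omega

/-- Two of the three edges share an `A`-vertex by pigeonhole. The third has the other `A`-vertex, so
not being isolated it meets one of the two in `B`; surjectivity keeps the remaining edge away from
that `B`-vertex. -/
theorem exists_path_of_card {W A B : Type*} [Fintype W] [DecidableEq W] [Fintype A] [Fintype B]
    {κ : W → A} {l : W → B} (hκ : Function.Surjective κ) (hl : Function.Surjective l)
    (hA : Fintype.card A = 2) (hB : Fintype.card B = 2) (hW : Fintype.card W = 3)
    (hns : ∀ j, ∃ j', j' ≠ j ∧ (κ j = κ j' ∨ l j = l j')) :
    ∃ i j k : W, i ≠ j ∧ i ≠ k ∧ j ≠ k ∧ (univ : Finset W) = {i, j, k} ∧ κ i = κ j ∧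
      κ i ≠ κ k ∧ l j = l k ∧ l i ≠ l j := by
  obtain ⟨p, q, hpq, hκpq⟩ := Fintype.exists_ne_map_eq_of_card_lt κ (by omega)
  obtain ⟨r, hr⟩ : ∃ r, r ∉ ({p, q} : Finset W) := by
    by_contra! h
    have h1 := card_le_card (fun x _ => h x : (univ : Finset W) ⊆ {p, q})
    have h2 := card_le_two (a := p) (b := q)
    rw [card_univ] at h1
    omega
  simp only [mem_insert, mem_singleton, not_or] at hr
  have huniv : (univ : Finset W) = {p, q, r} := by
    refine (eq_univ_of_card _ ?_).symm
    rw [hW, card_eq_three]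
    exact ⟨p, q, r, hpq, Ne.symm hr.1, Ne.symm hr.2, rfl⟩
  have hall : ∀ k, k = p ∨ k = q ∨ k = r := fun k => by simpa [huniv] using mem_univ k
  have hκr : κ p ≠ κ r := fun h => not_forall_eq_of_surjective hκ hA (κ p) fun j => by
    rcases hall j with rfl | rfl | rfl
    exacts [rfl, hκpq.symm, h.symm]
  obtain ⟨j, hj, hj'⟩ := hns r
  rcases hall j with rfl | rfl | rfl
  · have hlr : l r = l j := hj'.resolve_left fun h => hκr h.symm
    refine ⟨q, j, r, hpq.symm, Ne.symm hr.2, Ne.symm hr.1, ?_, hκpq.symm, hκpq ▸ hκr, hlr.symm,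
      fun h => not_forall_eq_of_surjective hl hB (l j) fun i => ?_⟩
    · rw [huniv, insert_comm]
    · rcases hall i with rfl | rfl | rfl
      exacts [rfl, h, hlr]
  · have hlr : l r = l j := hj'.resolve_left fun h => hκr (hκpq.trans h.symm)
    refine ⟨p, j, r, hpq, Ne.symm hr.1, Ne.symm hr.2, huniv, hκpq, hκr, hlr.symm,
      fun h => not_forall_eq_of_surjective hl hB (l j) fun i => ?_⟩
    rcases hall i with rfl | rfl | rfl
    exacts [h, rfl, hlr]
  · exact absurd rfl hj

variable {Ω W A B : Type*} [Fintype Ω] [Fintype W] [LinearOrder W] [Fintype A] [Fintype B]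
  [DecidableEq A] [DecidableEq B] {n : ℕ} {τ : Fin 3 → ℕ → Equiv.Perm Ω}
  {G : W → Fin (n + 1) → Fin (n + 1) → Ω → ℝ} {κ : W → A} {l : W → B}

theorem HaarSystem.freeSum_two (hG : HaarSystem n τ G)
    (hl : Function.Surjective l) (hA : Fintype.card A = 1) (hB : Fintype.card B = 2)
    (hW : Fintype.card W = 2) {m : ℕ} (hm : 1 ≤ m) {t : ℝ} (ht : 1 ≤ t) (htn : t ^ 16 = n + 1) :
    MomentLE (2 * m) (freeSum G κ l) (54 * m ^ 3 * t ^ 28) := by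
  obtain ⟨i, j, hij, huniv⟩ := card_eq_two.1 (card_univ.trans hW)
  have hall : ∀ k, k = i ∨ k = j := fun k => by simpa [huniv] using mem_univ k
  have hinj : Function.Injective l :=
    ((Fintype.bijective_iff_surjective_and_card l).2 ⟨hl, by rw [hW, hB]⟩).1
  have hsub : ∀ α, α = κ i := fun α => Fintype.card_le_one_iff.1 hA.le _ _
  have hBall : ∀ β, β = l i ∨ β = l j := fun β => by
    obtain ⟨k, rfl⟩ := hl β
    rcases hall k with rfl | rfl <;> simp
  have hm0 : (0 : ℝ) < m := by exact_mod_cast hm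
  have heq : freeSum G κ l =
      fun ω => ∑ a, ∑ b, G i a b ω * ∑ b' ∈ univ, G j a b' ω := by
    funext ω
    have h1 : ∀ x : A → Fin (n + 1), ∀ y : B → Fin (n + 1), ∏ k, G k (x (κ k)) (y (l k)) ω =
        G i (x (κ i)) (y (l i)) ω * G j (x (κ i)) (y (l j)) ω := fun x y => by
      rw [huniv, prod_pair hij, hsub (κ j)]
    simp only [freeSum, h1, mul_sum]
    rw [sum_fun_unique hsub (fun a => ∑ y : B → Fin (n + 1), G i a (y (l i)) ω *
      G j a (y (l j)) ω)]
    exact sum_congr rfl fun a _ => sum_fun_pair (hinj.ne hij) hBall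
      fun b b' => G i a b ω * G j a b' ω
  rw [heq]
  have := hG.pair hij univ hm ht htn (M := 3 * (2 * m : ℕ) * t ^ 8)
    (by push_cast; positivity) fun a => by
      simpa using hG.column (singleton_nonempty j) (fun _ => a) (m := 2 * m) (by omega)
        (R := t ^ 8) (by rw [← pow_mul, htn])
  convert this using 1
  push_cast
  ring

/-- Fix the parameter `b` shared by `j` and `k`. Edge `k` then contributes a column (`t ^ 8`), the
edges `i, j` a pair with `T = {b}` and `M = 1` (`t ^ 20`), and the sum over `b` is trivial (`t ^
16`). -/
theorem HaarSystem.freeSum_three (hG : HaarSystem n τ G) (hκ : Function.Surjective κ)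
    (hl : Function.Surjective l) (hA : Fintype.card A = 2) (hB : Fintype.card B = 2)
    (hW : Fintype.card W = 3) (hns : ∀ j, ∃ j', j' ≠ j ∧ (κ j = κ j' ∨ l j = l j'))
    {m : ℕ} (hm : 1 ≤ m) {t : ℝ} (ht : 1 ≤ t) (htn : t ^ 16 = n + 1) :
    MomentLE (2 * m) (freeSum G κ l) (216 * m ^ 3 * t ^ 44) := by
  obtain ⟨i, j, k, hij, hik, hjk, huniv, hκij, hκik, hljk, hlij⟩ :=
    exists_path_of_card hκ hl hA hB hW hns
  have hall : ∀ e, e = i ∨ e = j ∨ e = k := fun e => by simpa [huniv] using mem_univ e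
  have hAall : ∀ α, α = κ i ∨ α = κ k := fun α => by
    obtain ⟨e, rfl⟩ := hκ α
    rcases hall e with rfl | rfl | rfl <;> simp [hκij]
  have hBall : ∀ β, β = l i ∨ β = l j := fun β => by
    obtain ⟨e, rfl⟩ := hl β
    rcases hall e with rfl | rfl | rfl <;> simp [hljk]
  have hm0 : (0 : ℝ) < m := by exact_mod_cast hm
  have ht0 : 0 < t := by linarith
  have heq : freeSum G κ l = fun ω => ∑ b, (∑ a, G k a b ω) *
      ∑ a, ∑ b', G i a b' ω * ∑ b'' ∈ {b}, G j a b'' ω := by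
    funext ω
    have h1 : ∀ x : A → Fin (n + 1), ∀ y : B → Fin (n + 1), ∏ e, G e (x (κ e)) (y (l e)) ω =
        G i (x (κ i)) (y (l i)) ω * (G j (x (κ i)) (y (l j)) ω * G k (x (κ k)) (y (l j)) ω) :=
      fun x y => by
        rw [huniv, prod_insert (by simp [hij, hik]), prod_pair hjk, ← hκij, ← hljk]
    simp only [freeSum, h1, sum_singleton]
    simp only [fun x : A → Fin (n + 1) => sum_fun_pair hlij hBall fun b' b =>
      G i (x (κ i)) b' ω * (G j (x (κ i)) b ω * G k (x (κ k)) b ω)]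
    rw [sum_fun_pair hκik hAall fun a c => ∑ b', ∑ b, G i a b' ω * (G j a b ω * G k c b ω)]
    have h2 : ∀ b, (∑ a, G k a b ω) * ∑ a, ∑ b', G i a b' ω * G j a b ω =
        ∑ a, ∑ c, ∑ b', G i a b' ω * (G j a b ω * G k c b ω) := fun b => by
      rw [sum_mul_sum, sum_comm]
      refine sum_congr rfl fun a _ => sum_congr rfl fun c _ => ?_
      rw [mul_sum]
      exact sum_congr rfl fun b' _ => by ring
    simp only [h2]
    rw [sum_comm (s := (univ : Finset (Fin (n + 1))))
      (f := fun b a => ∑ c, ∑ b', G i a b' ω * (G j a b ω * G k c b ω))]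
    refine sum_congr rfl fun a _ => ?_
    rw [sum_comm (s := (univ : Finset (Fin (n + 1))))
      (f := fun b c => ∑ b', G i a b' ω * (G j a b ω * G k c b ω))]
    exact sum_congr rfl fun c _ => sum_comm
  rw [heq]
  have hfix : ∀ b, MomentLE (2 * m) (fun ω => (∑ a, G k a b ω) *
      ∑ a, ∑ b', G i a b' ω * ∑ b'' ∈ {b}, G j a b'' ω)
      ((3 * (2 * m : ℕ) * t ^ 8) * (9 * (2 * m : ℕ) ^ 2 * 1 * t ^ 20)) := by
    intro b
    refine MomentLE.mul (by push_cast; positivity) (by push_cast; positivity) ?_ ?_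
    · simpa using hG.swap.column (singleton_nonempty k) (fun _ => b) (m := 2 * m) (by omega)
        (R := t ^ 8) (by rw [← pow_mul, htn])
    · refine hG.pair hij {b} (m := 2 * m) (by omega) ht htn one_pos fun a =>
        MomentLE.of_abs_le fun ω => ?_
      simpa using hG.abs_le j a b ω
  have := MomentLE.sum (s := univ) (by omega) fun b _ => hfix b
  convert this using 1
  rw [card_univ, Fintype.card_fin]
  push_cast
  rw [← htn]
  ring

theorem HaarSystem.freeSum_connected_of_le [Nonempty W] (hG : HaarSystem n τ G)
    (hκ : Function.Surjective κ) (hl : Function.Surjective l)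
    (hns : ∀ j, ∃ j', j' ≠ j ∧ (κ j = κ j' ∨ l j = l j'))
    (hN : Fintype.card A + Fintype.card B ≤ Fintype.card W + 1)
    (hAB : Fintype.card A ≤ Fintype.card B) {m : ℕ} (hm : 1 ≤ m) {t : ℝ} (ht : 1 ≤ t)
    (htn : t ^ 16 = n + 1) :
    MomentLE (2 * m) (freeSum G κ l)
      ((216 * m ^ 3 * Fintype.card W * t ^ 15) ^ Fintype.card W) := by
  have hm1 : (1 : ℝ) ≤ m := by exact_mod_cast hm
  have hm3 : (m : ℝ) ≤ m ^ 3 := le_self_pow₀ hm1 (by norm_num)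
  have ht0 : 0 < t := by linarith
  have hW2 : 2 ≤ Fintype.card W := by
    obtain ⟨j⟩ := ‹Nonempty W›
    obtain ⟨j', hj', -⟩ := hns j
    exact Fintype.one_lt_card_iff.2 ⟨j', j, hj'⟩
  have hBW := Fintype.card_le_of_surjective l hl
  have : Nonempty A := Nonempty.map κ inferInstance
  have hA1 : 1 ≤ Fintype.card A := Fintype.card_pos
  generalize hv : Fintype.card W = v at *
  have hv1 : (1 : ℝ) ≤ v := by exact_mod_cast (by omega : 1 ≤ v)
  -- In powers of `t`, the left side is the column bound `n ^ (|A| + |B|/2)` and the right side is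
  -- the target.
  by_cases hgood : 16 * Fintype.card A + 8 * Fintype.card B ≤ 15 * v
  · refine (hG.freeSum_columns (κ := κ) hl hm (R := t ^ 8) (by positivity)
      (by rw [← pow_mul, htn])).mono (by positivity) ?_
    rw [← htn]
    push_cast
    have hb : (Fintype.card B : ℝ) ≤ v := by exact_mod_cast hBW
    calc (t ^ 16) ^ Fintype.card A * (3 * (m * Fintype.card B) * t ^ 8) ^ Fintype.card B
        = (3 * (m * Fintype.card B)) ^ Fintype.card B *
            t ^ (16 * Fintype.card A + 8 * Fintype.card B) := by
          rw [mul_pow _ (t ^ 8), ← pow_mul, ← pow_mul, pow_add]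
          ring
      _ ≤ (216 * (m ^ 3 * v)) ^ Fintype.card B * t ^ (15 * v) := by
          gcongr
          norm_num
      _ ≤ (216 * (m ^ 3 * v)) ^ v * t ^ (15 * v) := by
          gcongr
          have : (1 : ℝ) ≤ m ^ 3 * v := one_le_mul_of_one_le_of_one_le (hm1.trans hm3) hv1
          linarith
      _ = _ := by rw [pow_mul, ← mul_pow]; ring
  -- From `|A| ≤ |B|` and `|A| + |B| ≤ v + 1`, the left side of `hgood` is at most `12 (v + 1)`,
  -- which is at most `15 v` once `v ≥ 4`.
  · have hcases : (Fintype.card A = 1 ∧ Fintype.card B = 2 ∧ v = 2) ∨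
        (Fintype.card A = 2 ∧ Fintype.card B = 2 ∧ v = 3) := by omega
    have hM : (1 : ℝ) ≤ m ^ 3 := hm1.trans hm3
    rcases hcases with ⟨hA, hB, rfl⟩ | ⟨hA, hB, rfl⟩
    · refine (hG.freeSum_two hl hA hB hv hm ht htn).mono (by positivity) ?_
      calc 54 * (m : ℝ) ^ 3 * t ^ 28 ≤ (432 * m ^ 3) ^ 2 * t ^ 30 := by
            gcongr
            · nlinarith
            · norm_num
        _ = _ := by push_cast; ring
    · refine (hG.freeSum_three hκ hl hA hB hv hns hm ht htn).mono (by positivity) ?_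
      calc 216 * (m : ℝ) ^ 3 * t ^ 44 ≤ (648 * m ^ 3) ^ 3 * t ^ 45 := by
            gcongr
            · calc 216 * (m : ℝ) ^ 3 ≤ 648 * m ^ 3 := by linarith
                _ ≤ _ := le_self_pow₀ (by linarith) (by norm_num)
            · norm_num
        _ = _ := by push_cast; ring

theorem HaarSystem.freeSum_connected [Nonempty W] (hG : HaarSystem n τ G)
    (hκ : Function.Surjective κ) (hl : Function.Surjective l)
    (hns : ∀ j, ∃ j', j' ≠ j ∧ (κ j = κ j' ∨ l j = l j'))
    (hN : Fintype.card A + Fintype.card B ≤ Fintype.card W + 1)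
    {m : ℕ} (hm : 1 ≤ m) {t : ℝ} (ht : 1 ≤ t) (htn : t ^ 16 = n + 1) :
    MomentLE (2 * m) (freeSum G κ l)
      ((216 * m ^ 3 * Fintype.card W * t ^ 15) ^ Fintype.card W) := by
  rcases le_total (Fintype.card A) (Fintype.card B) with h | h
  · exact hG.freeSum_connected_of_le hκ hl hns hN h hm ht htn
  · rw [← freeSum_swap]
    refine hG.swap.freeSum_connected_of_le hl hκ (fun j => ?_) (by omega) h hm ht htn
    obtain ⟨j', h1, h2⟩ := hns j
    exact ⟨j', h1, h2.symm⟩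

end Connected

/-! ### Reduction to connected components -/

section Components

theorem sum_pi_fiber {A K T M : Type*} [Fintype A] [DecidableEq A] [Fintype K] [DecidableEq K]
    [Fintype T] [AddCommMonoid M] (c : A → K) (F : (∀ k, {α // c α = k} → T) → M) :
    ∑ x : A → T, F (fun _ α => x α) = ∑ z, F z := by
  refine Fintype.sum_bijective (fun (x : A → T) (k : K) (α : {α // c α = k}) => x α)
    ⟨fun x y h => ?_, fun z => ?_⟩ _ _ fun _ => rfl
  · funext α
    exact congrFun (congrFun h (c α)) ⟨α, rfl⟩
  · refine ⟨fun α => z (c α) ⟨α, rfl⟩, ?_⟩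
    funext k ⟨α, hα⟩
    subst hα
    rfl

/-- Rank–nullity for the coboundary map from vertex functions to edge functions: connectedness makes
its kernel at most one-dimensional. -/
theorem card_add_card_le_of_connected {W A B : Type*} [Fintype W] [Fintype A] [Fintype B]
    {κ : W → A} {l : W → B}
    (h : ∀ (u : A → ℝ) (w : B → ℝ), (∀ j, u (κ j) = w (l j)) →
      ∃ s, (∀ α, u α = s) ∧ ∀ β, w β = s) :
    Fintype.card A + Fintype.card B ≤ Fintype.card W + 1 := by
  let f : (A → ℝ) × (B → ℝ) →ₗ[ℝ] (W → ℝ) :=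
    { toFun := fun p j => p.1 (κ j) - p.2 (l j)
      map_add' := fun p q => by
        funext j
        simp only [Prod.fst_add, Prod.snd_add, Pi.add_apply]
        ring
      map_smul' := fun c p => by
        funext j
        simp only [Prod.smul_fst, Prod.smul_snd, Pi.smul_apply, smul_eq_mul, RingHom.id_apply]
        ring }
  have hker : LinearMap.ker f ≤ Submodule.span ℝ {((fun _ => 1, fun _ => 1) : (A → ℝ) × (B → ℝ))} := by
    intro p hp
    obtain ⟨s, hs1, hs2⟩ := h p.1 p.2 fun j => sub_eq_zero.1 (congrFun (LinearMap.mem_ker.1 hp) j)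
    refine Submodule.mem_span_singleton.2 ⟨s, Prod.ext ?_ ?_⟩
    · funext α
      simp [hs1]
    · funext β
      simp [hs2]
  have h1 := LinearMap.finrank_range_add_finrank_ker f
  have h2 := Submodule.finrank_mono hker
  have h3 := finrank_span_le_card (R := ℝ) ({((fun _ => 1, fun _ => 1) : (A → ℝ) × (B → ℝ))} :
    Set ((A → ℝ) × (B → ℝ)))
  have h4 := Submodule.finrank_le (LinearMap.range f)
  rw [Module.finrank_prod, Module.finrank_fintype_fun_eq_card,
    Module.finrank_fintype_fun_eq_card] at h1
  rw [Module.finrank_fintype_fun_eq_card] at h4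
  simp only [Set.toFinset_singleton, card_singleton] at h3
  omega

variable {Ω W A B : Type*} [Fintype W] [Fintype A] [Fintype B]
  [DecidableEq A] [DecidableEq B] {n : ℕ}
  {κ : W → A} {l : W → B}

theorem freeSum_eq_prod {K : Type*} [Fintype K] [DecidableEq K]
    (G : W → Fin (n + 1) → Fin (n + 1) → Ω → ℝ)
    {cA : A → K} {cB : B → K} (h : ∀ j, cA (κ j) = cB (l j)) (ω : Ω) :
    freeSum G κ l ω = ∏ c, freeSum (fun j : {j // cA (κ j) = c} => G j)
      (fun j => (⟨κ j, j.2⟩ : {α // cA α = c}))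
      (fun j => (⟨l j, (h j).symm.trans j.2⟩ : {β // cB β = c})) ω := by
  simp only [freeSum]
  rw [prod_univ_sum, Fintype.piFinset_univ, ← sum_pi_fiber cA]
  refine sum_congr rfl fun x _ => ?_
  rw [prod_univ_sum, Fintype.piFinset_univ, ← sum_pi_fiber cB]
  refine sum_congr rfl fun y _ => ?_
  exact (Fintype.prod_fiberwise (fun j => cA (κ j)) fun j => G j (x (κ j)) (y (l j)) ω).symm

variable [Fintype Ω] [LinearOrder W] {τ : Fin 3 → ℕ → Equiv.Perm Ω}
  {G : W → Fin (n + 1) → Fin (n + 1) → Ω → ℝ}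

/-- Components are the classes of the relation generated by the edges. Hölder over at most
`Fintype.card W` components replaces `m` by `m * Fintype.card K`, and its cube raises the power of
`Fintype.card W` from 1 to 4. -/
theorem HaarSystem.freeSum_le (hG : HaarSystem n τ G)
    (hκ : Function.Surjective κ) (hl : Function.Surjective l)
    (hns : ∀ j, ∃ j', j' ≠ j ∧ (κ j = κ j' ∨ l j = l j'))
    {m : ℕ} (hm : 1 ≤ m) {t : ℝ} (ht : 1 ≤ t) (htn : t ^ 16 = n + 1) :
    MomentLE (2 * m) (freeSum G κ l)
      ((216 * m ^ 3 * Fintype.card W ^ 4 * t ^ 15) ^ Fintype.card W) := by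
  classical
  let r : A ⊕ B → A ⊕ B → Prop := fun u w => ∃ j, u = Sum.inl (κ j) ∧ w = Sum.inr (l j)
  let K := Quot r
  let cA : A → K := fun α => Quot.mk r (Sum.inl α)
  let cB : B → K := fun β => Quot.mk r (Sum.inr β)
  have hc : ∀ j, cA (κ j) = cB (l j) := fun j => Quot.sound ⟨j, rfl, rfl⟩
  have hsurj : Function.Surjective fun j => cA (κ j) := by
    intro c
    induction c using Quot.ind with
    | mk u =>
      rcases u with α | β
      · obtain ⟨j, rfl⟩ := hκ α
        exact ⟨j, rfl⟩
      · obtain ⟨j, rfl⟩ := hl β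
        exact ⟨j, hc j⟩
  have : Finite K := Finite.of_surjective _ hsurj
  have : Fintype K := Fintype.ofFinite K
  have hKW : Fintype.card K ≤ Fintype.card W := Fintype.card_le_of_surjective _ hsurj
  rw [show freeSum G κ l = _ from funext fun ω => freeSum_eq_prod G hc ω]
  have hbound : (216 * (m : ℝ) ^ 3 * Fintype.card W ^ 4 * t ^ 15) ^ Fintype.card W =
      ∏ c : K, (216 * (m : ℝ) ^ 3 * Fintype.card W ^ 4 * t ^ 15) ^
        Fintype.card {j // cA (κ j) = c} := by
    have := Fintype.prod_fiberwise (fun j => cA (κ j))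
      fun _ => 216 * (m : ℝ) ^ 3 * Fintype.card W ^ 4 * t ^ 15
    simpa using this.symm
  have hm0 : (0 : ℝ) < m := by exact_mod_cast hm
  have ht0 : 0 < t := by linarith
  rcases isEmpty_or_nonempty W with hW | hW
  · have : IsEmpty K := ⟨fun c => hW.elim (hsurj c).choose⟩
    exact MomentLE.of_abs_le (by simp)
  have hW0 : (0 : ℝ) < Fintype.card W := by exact_mod_cast Fintype.card_pos
  have : Nonempty K := Nonempty.map (fun j => cA (κ j)) hW
  rw [hbound]
  refine MomentLE.prod (fun c => by positivity) fun c _ => ?_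
  have : Nonempty {j // cA (κ j) = c} := nonempty_subtype.2 (hsurj c)
  have hcon := HaarSystem.freeSum_connected (m := m * Fintype.card K)
    (κ := fun j : {j // cA (κ j) = c} => (⟨κ j, j.2⟩ : {α // cA α = c}))
    (l := fun j => (⟨l j, (hc j).symm.trans j.2⟩ : {β // cB β = c}))
    (hG.comp (g := fun j : {j // cA (κ j) = c} => (j : W)) fun _ _ h => h) ?_ ?_ ?_ ?_
    (Nat.mul_pos hm Fintype.card_pos) ht htn
  · rw [card_univ, mul_assoc]
    refine hcon.mono (by positivity) ?_
    have h1 : (Fintype.card K : ℝ) ≤ Fintype.card W := by exact_mod_cast hKW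
    have h2 : (Fintype.card {j // cA (κ j) = c} : ℝ) ≤ Fintype.card W := by
      exact_mod_cast Fintype.card_subtype_le _
    refine pow_le_pow_left₀ (by positivity) ?_ _
    push_cast
    calc 216 * ((m : ℝ) * Fintype.card K) ^ 3 * Fintype.card {j // cA (κ j) = c} * t ^ 15
        ≤ 216 * ((m : ℝ) * Fintype.card W) ^ 3 * Fintype.card W * t ^ 15 := by gcongr
      _ = _ := by ring
  · rintro ⟨α, hα⟩
    obtain ⟨j, rfl⟩ := hκ α
    exact ⟨⟨j, hα⟩, rfl⟩
  · rintro ⟨β, hβ⟩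
    obtain ⟨j, rfl⟩ := hl β
    exact ⟨⟨j, (hc j).trans hβ⟩, rfl⟩
  · rintro ⟨j, hj⟩
    obtain ⟨j', hne, h⟩ := hns j
    have hj' : cA (κ j') = c := by
      rcases h with h | h
      · rw [← h, hj]
      · rw [hc, ← h, ← hc, hj]
    refine ⟨⟨j', hj'⟩, fun h => hne (congrArg Subtype.val h), ?_⟩
    exact h.imp (fun h => Subtype.ext h) fun h => Subtype.ext h
  · refine card_add_card_le_of_connected
      (κ := fun j : {j // cA (κ j) = c} => (⟨κ j, j.2⟩ : {α // cA α = c}))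
      (l := fun j => (⟨l j, (hc j).symm.trans j.2⟩ : {β // cB β = c})) fun u w huw => ?_
    -- Extended by zero off the component, the pair `(u, w)` descends to the quotient; its value at
    -- `c` is the required constant.
    let U : A ⊕ B → ℝ := Sum.elim (fun α => if h : cA α = c then u ⟨α, h⟩ else 0)
      fun β => if h : cB β = c then w ⟨β, h⟩ else 0
    have hU : ∀ a b, r a b → U a = U b := by
      rintro _ _ ⟨j, rfl, rfl⟩
      by_cases h : cA (κ j) = c
      · have h' : cB (l j) = c := (hc j).symm.trans h
        simpa [U, h, h'] using huw ⟨j, h⟩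
      · have h' : ¬ cB (l j) = c := fun h' => h ((hc j).trans h')
        simp [U, h, h']
    refine ⟨Quot.lift U hU c, ?_, ?_⟩
    · rintro ⟨α, rfl⟩
      simp [U, cA]
    · rintro ⟨β, rfl⟩
      simp [U, cB]

end Components

/-! ### From coincidence patterns to free sums -/

section Kernels

/-- Every index shares its `a`-value or its `b`-value with another index. -/
def NoIsolated {W S T : Type*} (a : W → S) (b : W → T) : Prop :=
  ∀ j, ∃ j', j' ≠ j ∧ (a j = a j' ∨ b j = b j')

/-- The two functions have the same fibres. -/
def SameKer {W S T : Type*} (a : W → S) (b : W → T) : Prop :=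
  ∀ i j, a i = a j ↔ b i = b j

theorem NoIsolated.congr {W S T S' T' : Type*} {a : W → S} {b : W → T} {a' : W → S'} {b' : W → T'}
    (ha : SameKer a a') (hb : SameKer b b') : NoIsolated a b ↔ NoIsolated a' b' := by
  simp only [NoIsolated, ha _ _, hb _ _]

theorem SameKer.ker_eq {W S T : Type*} {a : W → S} {b : W → T} (h : SameKer a b) :
    Setoid.ker a = Setoid.ker b :=
  Setoid.ext h

/-- A choice of a representative in each fibre of `a`. -/
noncomputable def fiberRep {W T : Type*} (a : W → T) (j : W) : W :=
  (Quotient.mk (Setoid.ker a) j).out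

theorem sameKer_fiberRep {W T : Type*} (a : W → T) : SameKer a (fiberRep a) := by
  intro i j
  simp only [fiberRep, Quotient.out_inj, Quotient.eq]
  rfl

theorem SameKer.fiberRep_eq {W S T : Type*} {a : W → S} {b : W → T} (h : SameKer a b) :
    fiberRep a = fiberRep b := by
  unfold fiberRep
  rw [h.ker_eq]

theorem fiberRep_eq_iff {W T : Type*} {a : W → T} {κ : W → W} :
    fiberRep a = κ ↔ fiberRep κ = κ ∧ SameKer a κ := by
  constructor
  · rintro rfl
    exact ⟨(sameKer_fiberRep a).fiberRep_eq.symm, sameKer_fiberRep a⟩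
  · rintro ⟨h1, h2⟩
    rw [h2.fiberRep_eq, h1]

-- The fixed points of `fiberRep` are canonical names for the equivalence relations on `W`, so each
-- pattern of coincidences is counted once.
open Classical in
theorem sum_eq_sum_sameKer {W T M : Type*} [Fintype W] [DecidableEq W] [Fintype T] [AddCommMonoid M]
    (F : (W → T) → M) :
    ∑ a, F a = ∑ κ : W → W with fiberRep κ = κ, ∑ a with SameKer a κ, F a := by
  rw [← sum_fiberwise univ (fiberRep (W := W) (T := T)) F, sum_filter]
  refine sum_congr rfl fun κ _ => ?_
  split_ifs with h
  · exact sum_congr (filter_congr fun a _ => ⟨fun h' => (fiberRep_eq_iff.1 h').2, fun h' =>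
      fiberRep_eq_iff.2 ⟨h, h'⟩⟩) fun _ _ => rfl
  · rw [filter_false_of_mem fun a _ h' => h (fiberRep_eq_iff.1 h').1, sum_empty]

open Classical in
theorem sum_sameKer_eq_sum_injective {W T A M : Type*} [Fintype W] [DecidableEq W] [Fintype T]
    [DecidableEq T] [Fintype A] [DecidableEq A] [AddCommMonoid M] {κ : W → A} (hκ : Function.Surjective κ) (F : (W → T) → M) :
    ∑ a with SameKer a κ, F a = ∑ x : A → T with Function.Injective x, F (x ∘ κ) := by
  symm
  refine sum_bij (fun x _ => x ∘ κ) ?_ ?_ ?_ fun _ _ => rfl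
  · intro x hx
    have hx : Function.Injective x := by simpa using hx
    exact mem_filter.2 ⟨mem_univ _, fun i j => hx.eq_iff⟩
  · intro x _ y _ h
    exact hκ.injective_comp_right h
  · intro a ha
    have ha : SameKer a κ := by simpa using ha
    have hs : ∀ j, a (Function.surjInv hκ (κ j)) = a j := fun j =>
      (ha _ _).2 (Function.surjInv_eq hκ _)
    refine ⟨a ∘ Function.surjInv hκ, ?_, funext hs⟩
    simp only [mem_filter, mem_univ, true_and]
    intro α β h
    have := (ha _ _).1 h
    rwa [Function.surjInv_eq hκ, Function.surjInv_eq hκ] at this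

/-- A left inverse is prescribed on the range of `x` and arbitrary elsewhere, so injective `x` all
have equally many, and other `x` have none. -/
theorem card_leftInverse_mul {A T : Type*} [Fintype A] [DecidableEq A] [Fintype T]
    [DecidableEq T] (x : A → T) :
    #{φ : T → A | ∀ α, φ (x α) = α} * Fintype.card A ^ Fintype.card A =
      if Function.Injective x then Fintype.card A ^ Fintype.card T else 0 := by
  split_ifs with hx
  · have hset : ({φ : T → A | ∀ α, φ (x α) = α} : Finset (T → A)) =
        Fintype.piFinset fun t => {a : A | ∀ α, x α = t → a = α} := by
      ext φ
      simp only [mem_filter, mem_univ, true_and, Fintype.mem_piFinset]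
      exact ⟨fun h t α hα => hα ▸ h α, fun h α => h (x α) α rfl⟩
    have hcard : ∀ t, #{a : A | ∀ α, x α = t → a = α} =
        if t ∈ univ.image x then 1 else Fintype.card A := by
      intro t
      split_ifs with ht
      · obtain ⟨β, -, rfl⟩ := mem_image.1 ht
        rw [card_eq_one]
        refine ⟨β, ext fun a => ?_⟩
        simp only [mem_filter, mem_univ, true_and, mem_singleton]
        exact ⟨fun h => h β rfl, fun h α hα => h.trans (hx hα).symm⟩
      · rw [filter_true_of_mem, card_univ]
        intro a _ α hα
        exact absurd (mem_image.2 ⟨α, mem_univ _, hα⟩) ht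
    rw [hset, Fintype.card_piFinset, prod_congr rfl fun t _ => hcard t, prod_ite, prod_const_one,
      one_mul, prod_const, ← pow_add]
    congr 1
    have h1 := card_filter_add_card_filter_not (s := (univ : Finset T)) (fun t => t ∈ univ.image x)
    have h2 : #{t : T | t ∈ univ.image x} = Fintype.card A := by
      rw [filter_mem_eq_inter, univ_inter, card_image_of_injective _ hx, card_univ]
    rw [card_univ] at h1
    omega
  · rw [card_eq_zero.2, zero_mul]
    refine filter_eq_empty_iff.2 fun φ _ h => hx ?_
    exact Function.LeftInverse.injective h

/-- A sum over injective functions is an average of sums over functions with values in prescribed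
disjoint sets. -/
theorem sum_injective_eq {A T : Type*} [Fintype A] [DecidableEq A] [Nonempty A] [Fintype T]
    [DecidableEq T] (F : (A → T) → ℝ) :
    ∑ x with Function.Injective x, F x =
      (Fintype.card A ^ Fintype.card A / Fintype.card A ^ Fintype.card T : ℝ) *
        ∑ φ : T → A, ∑ x with ∀ α, φ (x α) = α, F x := by
  have hA : (Fintype.card A : ℝ) ≠ 0 := by exact_mod_cast Fintype.card_pos.ne'
  have h1 : ∑ φ : T → A, ∑ x with ∀ α, φ (x α) = α, F x =
      ∑ x, #{φ : T → A | ∀ α, φ (x α) = α} * F x := by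
    simp only [sum_filter]
    rw [sum_comm]
    refine sum_congr rfl fun x _ => ?_
    rw [← sum_filter, sum_const, nsmul_eq_mul]
  rw [h1, mul_sum, sum_filter]
  refine sum_congr rfl fun x _ => ?_
  have h2 : ((#{φ : T → A | ∀ α, φ (x α) = α} : ℝ) * Fintype.card A ^ Fintype.card A) =
      if Function.Injective x then (Fintype.card A : ℝ) ^ Fintype.card T else 0 := by
    exact_mod_cast card_leftInverse_mul x
  rw [div_mul_eq_mul_div, ← mul_assoc, mul_comm (_ ^ _) (Nat.cast _), h2]
  split_ifs <;> field_simp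
  simp

variable {Ω W A B : Type*} [Fintype W] [Fintype A] [Fintype B]
  [DecidableEq A] [DecidableEq B] {n : ℕ}
  {τ : Fin 3 → ℕ → Equiv.Perm Ω} {G : W → Fin (n + 1) → Fin (n + 1) → Ω → ℝ}
  {κ : W → A} {l : W → B}

/-- For fixed colourings the constraint separates over vertices. Every vertex lies on an edge, so
the constraint can be absorbed into the factors `G j`, which makes the sum free. -/
theorem sum_injective_eq_sum_freeSum [Nonempty A] [Nonempty B] (hκ : Function.Surjective κ)
    (hl : Function.Surjective l) (ω : Ω) :
    ∑ x : A → Fin (n + 1) with Function.Injective x,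
      ∑ y : B → Fin (n + 1) with Function.Injective y, ∏ j, G j (x (κ j)) (y (l j)) ω =
    ((Fintype.card A ^ Fintype.card A / Fintype.card A ^ (n + 1) : ℝ) *
      (Fintype.card B ^ Fintype.card B / Fintype.card B ^ (n + 1) : ℝ)) *
      ∑ p : (Fin (n + 1) → A) × (Fin (n + 1) → B),
        freeSum (fun j a b ω => if p.1 a = κ j ∧ p.2 b = l j then G j a b ω else 0) κ l ω := by
  rw [sum_injective_eq, mul_assoc, Fintype.card_fin]
  congr 1
  simp only [sum_injective_eq, Fintype.card_fin, ← mul_sum]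
  congr 1
  rw [Fintype.sum_prod_type]
  refine sum_congr rfl fun φ _ => ?_
  simp only [freeSum]
  rw [sum_comm]
  refine sum_congr rfl fun ψ _ => ?_
  rw [sum_filter]
  refine sum_congr rfl fun x _ => ?_
  rw [sum_filter]
  split_ifs with hx
  · refine sum_congr rfl fun y _ => ?_
    split_ifs with hy
    · exact prod_congr rfl fun j _ => by simp [hx, hy]
    · push Not at hy
      obtain ⟨β, hβ⟩ := hy
      obtain ⟨j, rfl⟩ := hl β
      exact (prod_eq_zero (mem_univ j) (by simp [hβ])).symm
  · push Not at hx
    obtain ⟨α, hα⟩ := hx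
    obtain ⟨j, rfl⟩ := hκ α
    exact (sum_eq_zero fun y _ => prod_eq_zero (mem_univ j) (by simp [hα])).symm

variable [LinearOrder W]

theorem HaarSystem.injective_sum_le [Fintype Ω] [Nonempty W] (hG : HaarSystem n τ G)
    (hκ : Function.Surjective κ) (hl : Function.Surjective l) (hns : NoIsolated κ l)
    {m : ℕ} (hm : 1 ≤ m) {t : ℝ} (ht : 1 ≤ t) (htn : t ^ 16 = n + 1) :
    MomentLE (2 * m) (fun ω => ∑ x : A → Fin (n + 1) with Function.Injective x,
      ∑ y : B → Fin (n + 1) with Function.Injective y, ∏ j, G j (x (κ j)) (y (l j)) ω)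
      ((216 * m ^ 3 * Fintype.card W ^ 6 * t ^ 15) ^ Fintype.card W) := by
  have : Nonempty A := Nonempty.map κ inferInstance
  have : Nonempty B := Nonempty.map l inferInstance
  have hA0 : (0 : ℝ) < Fintype.card A := by exact_mod_cast Fintype.card_pos
  have hB0 : (0 : ℝ) < Fintype.card B := by exact_mod_cast Fintype.card_pos
  have hW1 : (1 : ℝ) ≤ Fintype.card W := by exact_mod_cast Fintype.card_pos
  have hAW := Fintype.card_le_of_surjective κ hκ
  have hBW := Fintype.card_le_of_surjective l hl
  have hAW' : (Fintype.card A : ℝ) ≤ Fintype.card W := by exact_mod_cast hAW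
  have hBW' : (Fintype.card B : ℝ) ≤ Fintype.card W := by exact_mod_cast hBW
  have ht0 : 0 < t := by linarith
  simp only [sum_injective_eq_sum_freeSum hκ hl]
  have h1 := (MomentLE.sum (s := (univ : Finset ((Fin (n + 1) → A) × (Fin (n + 1) → B))))
    (by omega : 1 ≤ 2 * m) fun p _ =>
    (hG.restrict fun j a b => p.1 a = κ j ∧ p.2 b = l j).freeSum_le hκ hl hns hm ht htn).const_mul
    ((Fintype.card A ^ Fintype.card A / Fintype.card A ^ (n + 1) : ℝ) *
      (Fintype.card B ^ Fintype.card B / Fintype.card B ^ (n + 1) : ℝ))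
  refine h1.mono (by positivity) ?_
  rw [abs_of_pos (by positivity), card_univ, Fintype.card_prod, Fintype.card_fun, Fintype.card_fun,
    Fintype.card_fin]
  push_cast
  -- The number of colourings cancels the denominators; only `|A| ^ |A| * |B| ^ |B|` survives.
  calc _ = (Fintype.card A : ℝ) ^ Fintype.card A * (Fintype.card B : ℝ) ^ Fintype.card B *
        (216 * m ^ 3 * Fintype.card W ^ 4 * t ^ 15) ^ Fintype.card W := by
        field_simp
    _ ≤ (Fintype.card W : ℝ) ^ Fintype.card W * (Fintype.card W : ℝ) ^ Fintype.card W *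
        (216 * m ^ 3 * Fintype.card W ^ 4 * t ^ 15) ^ Fintype.card W := by
        gcongr
        · exact (pow_le_pow_left₀ hA0.le hAW' _).trans (pow_le_pow_right₀ hW1 hAW)
        · exact (pow_le_pow_left₀ hB0.le hBW' _).trans (pow_le_pow_right₀ hW1 hBW)
    _ = _ := by
        rw [← mul_pow, ← mul_pow]
        ring

-- Whether a pair has an isolated index depends only on its two kernels. There are at most `|W| ^ (2
-- |W|)` kernel pairs, hence two more powers of `|W|` per edge.
open Classical in
theorem HaarSystem.noIsolated_sum_le [Fintype Ω] [Nonempty W] (hG : HaarSystem n τ G)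
    {m : ℕ} (hm : 1 ≤ m) {t : ℝ} (ht : 1 ≤ t) (htn : t ^ 16 = n + 1) :
    MomentLE (2 * m) (fun ω => ∑ a : W → Fin (n + 1), ∑ b : W → Fin (n + 1),
      if NoIsolated a b then ∏ j, G j (a j) (b j) ω else 0)
      ((216 * m ^ 3 * Fintype.card W ^ 8 * t ^ 15) ^ Fintype.card W) := by
  have ht0 : 0 < t := by linarith
  set P : Finset ((W → W) × (W → W)) :=
    ((univ.filter fun κ => fiberRep κ = κ) ×ˢ univ.filter fun l => fiberRep l = l).filter
      fun p => NoIsolated p.1 p.2 with hP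
  have heq : (fun ω => ∑ a : W → Fin (n + 1), ∑ b : W → Fin (n + 1),
      if NoIsolated a b then ∏ j, G j (a j) (b j) ω else 0) = fun ω => ∑ p ∈ P,
      ∑ x : Set.range p.1 → Fin (n + 1) with Function.Injective x,
      ∑ y : Set.range p.2 → Fin (n + 1) with Function.Injective y,
        ∏ j, G j (x (Set.rangeFactorization p.1 j)) (y (Set.rangeFactorization p.2 j)) ω := by
    funext ω
    rw [sum_eq_sum_sameKer]
    simp only [fun a : W → Fin (n + 1) => sum_eq_sum_sameKer (W := W) (T := Fin (n + 1))
      fun b => if NoIsolated a b then ∏ j, G j (a j) (b j) ω else 0]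
    rw [hP, sum_filter (p := fun p : (W → W) × (W → W) => NoIsolated p.1 p.2), sum_product]
    refine sum_congr rfl fun κ _ => ?_
    rw [sum_comm]
    refine sum_congr rfl fun l _ => ?_
    have hker : ∀ κ : W → W, ∀ a : W → Fin (n + 1),
        SameKer a κ ↔ SameKer a (Set.rangeFactorization κ) := fun κ a => by
      simp [SameKer, Set.rangeFactorization, Subtype.ext_iff]
    split_ifs with h
    · have h1 : ∀ a ∈ ({a | SameKer a κ} : Finset (W → Fin (n + 1))),
          ∑ b : W → Fin (n + 1) with SameKer b l,
            (if NoIsolated a b then ∏ j, G j (a j) (b j) ω else 0) =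
          ∑ b : W → Fin (n + 1) with SameKer b l, ∏ j, G j (a j) (b j) ω := by
        intro a ha
        refine sum_congr rfl fun b hb => if_pos ?_
        exact (NoIsolated.congr (by simpa using ha) (by simpa using hb)).2 h
      rw [sum_congr rfl h1]
      simp only [hker]
      rw [sum_sameKer_eq_sum_injective Set.rangeFactorization_surjective]
      refine sum_congr rfl fun x _ => ?_
      rw [sum_sameKer_eq_sum_injective Set.rangeFactorization_surjective]
      rfl
    · refine sum_eq_zero fun a ha => sum_eq_zero fun b hb => if_neg fun hab => h ?_
      exact (NoIsolated.congr (by simpa using ha) (by simpa using hb)).1 hab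
  rw [heq]
  refine (MomentLE.sum (by omega) fun p hp => hG.injective_sum_le
    Set.rangeFactorization_surjective Set.rangeFactorization_surjective ?_ hm ht htn).mono
    (by positivity) ?_
  · have h := (mem_filter.1 hp).2
    exact (NoIsolated.congr (fun i j => by simp [Set.rangeFactorization, Subtype.ext_iff])
      (fun i j => by simp [Set.rangeFactorization, Subtype.ext_iff])).1 h
  · have hc : (#P : ℝ) ≤ (Fintype.card W : ℝ) ^ Fintype.card W *
        (Fintype.card W : ℝ) ^ Fintype.card W := by
      have : #P ≤ Fintype.card W ^ Fintype.card W * Fintype.card W ^ Fintype.card W := by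
        simpa using card_le_univ P
      exact_mod_cast this
    calc _ ≤ (Fintype.card W : ℝ) ^ Fintype.card W * (Fintype.card W : ℝ) ^ Fintype.card W *
        (216 * m ^ 3 * Fintype.card W ^ 6 * t ^ 15) ^ Fintype.card W := by gcongr
      _ = _ := by
        rw [← mul_pow, ← mul_pow]
        ring

end Kernels

/-! ### The dyadic grid, binary digits and the cube -/

section Digits

theorem mem_dyadicInterval_iff {s j : ℕ} {x : ℝ} (hx : 0 ≤ x) :
    x ∈ dyadicInterval s j ↔ ⌊2 ^ s * x⌋₊ = j := by
  rw [Nat.floor_eq_iff (by positivity), dyadicInterval, Set.mem_Ico, div_le_iff₀ (by positivity),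
    lt_div_iff₀ (by positivity), mul_comm x]

theorem haar_eq {s j : ℕ} {x : ℝ} (hx : 0 ≤ x) :
    haar s j x = -(if ⌊2 ^ (s + 1) * x⌋₊ = 2 * j then 1 else 0) +
      if ⌊2 ^ (s + 1) * x⌋₊ = 2 * j + 1 then 1 else 0 := by
  have ind : ∀ a, (dyadicInterval (s + 1) a).indicator (1 : ℝ → ℝ) x =
      if ⌊2 ^ (s + 1) * x⌋₊ = a then 1 else 0 := fun a => by
    split_ifs with h
    · exact Set.indicator_of_mem ((mem_dyadicInterval_iff hx).2 h) _
    · exact Set.indicator_of_notMem (fun h' => h ((mem_dyadicInterval_iff hx).1 h')) _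
  rw [haar, ind, ind]

theorem floor_div_two_pow {M s : ℕ} (h : s ≤ M) (x : ℝ) :
    ⌊2 ^ s * x⌋₊ = ⌊2 ^ M * x⌋₊ / 2 ^ (M - s) := by
  rw [← Nat.floor_div_natCast]
  congr 1
  have h2 : (2 : ℝ) ^ M = 2 ^ s * 2 ^ (M - s) := by rw [← pow_add, Nat.add_sub_cancel' h]
  push_cast
  rw [h2]
  field_simp

theorem haar_eq_haar_floor {M s j : ℕ} (h : s < M) {x : ℝ} (hx : 0 ≤ x) :
    haar s j x = haar s j (⌊2 ^ M * x⌋₊ / 2 ^ M) := by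
  rw [haar_eq hx, haar_eq (by positivity), floor_div_two_pow h x, floor_div_two_pow h (_ / _),
    mul_div_cancel₀ _ (by positivity), Nat.floor_natCast]

theorem haar_grid {M s j K : ℕ} (h : s < M) :
    haar s j ((K : ℝ) / 2 ^ M) = -(if K / 2 ^ (M - 1 - s) = 2 * j then 1 else 0) +
      if K / 2 ^ (M - 1 - s) = 2 * j + 1 then 1 else 0 := by
  rw [haar_eq (by positivity), floor_div_two_pow h (_ / _), mul_div_cancel₀ _ (by positivity),
    Nat.floor_natCast, Nat.sub_sub, add_comm 1 s]

theorem sum_abs_haar_le (s : ℕ) {x : ℝ} (hx : 0 ≤ x) :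
    ∑ j : Fin (2 ^ s), |haar s j x| ≤ 1 := by
  have h : ∀ j : Fin (2 ^ s), |haar s j x| ≤
      if ⌊2 ^ (s + 1) * x⌋₊ / 2 = (j : ℕ) then (1 : ℝ) else 0 := by
    intro j
    rw [haar_eq hx]
    generalize ⌊2 ^ (s + 1) * x⌋₊ = Q
    by_cases h1 : Q = 2 * j
    · rw [if_pos h1, if_neg (by omega), if_pos (by omega)]
      norm_num
    by_cases h2 : Q = 2 * j + 1
    · rw [if_neg h1, if_pos h2, if_pos (by omega)]
      norm_num
    · rw [if_neg h1, if_neg h2]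
      split_ifs <;> norm_num
  refine (sum_le_sum fun j _ => h j).trans ?_
  rw [sum_boole]
  have : #{j : Fin (2 ^ s) | ⌊2 ^ (s + 1) * x⌋₊ / 2 = (j : ℕ)} ≤ 1 := by
    refine card_le_one.2 fun a ha b hb => Fin.ext ?_
    rw [← (mem_filter.1 ha).2, ← (mem_filter.1 hb).2]
  exact_mod_cast this

/-- Flip the binary digit of weight `2 ^ (M - 1 - i)`. -/
def flipDigit {M : ℕ} (i : ℕ) (K : Fin (2 ^ M)) : Fin (2 ^ M) :=
  if h : i < M then
    ⟨K ^^^ 2 ^ (M - 1 - i), Nat.xor_lt_two_pow K.2 (Nat.pow_lt_pow_right one_lt_two (by omega))⟩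
  else K

theorem flipDigit_involutive {M : ℕ} (i : ℕ) :
    Function.Involutive (flipDigit i : Fin (2 ^ M) → Fin (2 ^ M)) := by
  intro K
  unfold flipDigit
  split_ifs
  · simp
  · rfl

/-- Digit `s` decides in which half of its dyadic interval of length `2 ^ (-s)` a point lies;
flipping it is `Q ^^^ 1`, which exchanges `2 * j` and `2 * j + 1`. -/
theorem haar_flipDigit_self {M s j : ℕ} (h : s < M) (K : Fin (2 ^ M)) :
    haar s j ((flipDigit s K : ℕ) / 2 ^ M) = -haar s j ((K : ℕ) / 2 ^ M) := by
  rw [haar_grid h, haar_grid h, flipDigit, dif_pos h]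
  simp only
  have h1 : ((K : ℕ) ^^^ 2 ^ (M - 1 - s)) / 2 ^ (M - 1 - s) =
      ((K : ℕ) / 2 ^ (M - 1 - s)) ^^^ 1 := by
    rw [← Nat.shiftRight_eq_div_pow, Nat.shiftRight_xor_distrib, Nat.shiftRight_eq_div_pow,
      Nat.shiftRight_eq_div_pow, Nat.div_self (by positivity)]
  rw [h1]
  generalize (K : ℕ) / 2 ^ (M - 1 - s) = Q
  have h2 : (Q ^^^ 1) % 2 = (Q + 1) % 2 := Nat.xor_mod_two_eq
  have h3 : (Q ^^^ 1) / 2 = Q / 2 := by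
    have := Nat.shiftRight_xor_distrib (a := Q) (b := 1) (i := 1)
    simpa [Nat.shiftRight_eq_div_pow] using this
  have e1 : Q ^^^ 1 = 2 * j ↔ Q = 2 * j + 1 := by omega
  have e2 : Q ^^^ 1 = 2 * j + 1 ↔ Q = 2 * j := by omega
  simp only [e1, e2]
  ring

theorem haar_flipDigit_of_lt {M s i j : ℕ} (h : s < M) (hi : s < i) (K : Fin (2 ^ M)) :
    haar s j ((flipDigit i K : ℕ) / 2 ^ M) = haar s j ((K : ℕ) / 2 ^ M) := by
  unfold flipDigit
  split_ifs with hiM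
  · rw [haar_grid h, haar_grid h]
    have h1 : ((K : ℕ) ^^^ 2 ^ (M - 1 - i)) / 2 ^ (M - 1 - s) = (K : ℕ) / 2 ^ (M - 1 - s) := by
      rw [← Nat.shiftRight_eq_div_pow, Nat.shiftRight_xor_distrib, Nat.shiftRight_eq_div_pow,
        Nat.shiftRight_eq_div_pow, Nat.div_eq_of_lt (Nat.pow_lt_pow_right one_lt_two (by omega)),
        Nat.xor_zero]
    rw [h1]
  · rfl

/-- Flip the `i`-th binary digit of the `k`-th coordinate. -/
def flipCoord (M : ℕ) (k : Fin 3) (i : ℕ) : Equiv.Perm (Fin 3 → Fin (2 ^ M)) :=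
  Function.Involutive.toPerm (fun J => Function.update J k (flipDigit i (J k))) fun J => by
    simp [flipDigit_involutive i (J k)]

theorem flipCoord_apply (M : ℕ) (k : Fin 3) (i : ℕ) (J : Fin 3 → Fin (2 ^ M)) :
    flipCoord M k i J = Function.update J k (flipDigit i (J k)) := rfl

/-- The lower corner of a dyadic cell. -/
noncomputable def corner (M : ℕ) (J : Fin 3 → Fin (2 ^ M)) (k : Fin 3) : ℝ := (J k : ℕ) / 2 ^ M

theorem haarRect_flipCoord {M : ℕ} {r : Fin 3 → ℕ} (R : Rect r) (k : Fin 3) (i : ℕ) (c : ℝ)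
    (J : Fin 3 → Fin (2 ^ M)) (h : haar (r k) (R k) ((flipDigit i (J k) : ℕ) / 2 ^ M) =
      c * haar (r k) (R k) ((J k : ℕ) / 2 ^ M)) :
    haarRect r R (corner M (flipCoord M k i J)) = c * haarRect r R (corner M J) := by
  unfold haarRect
  rw [← mul_prod_erase univ _ (mem_univ k),
    ← mul_prod_erase univ (fun k => haar (r k) (R k) (corner M J k)) (mem_univ k), ← mul_assoc]
  congr 1
  · simpa [corner, flipCoord_apply] using h
  · refine prod_congr rfl fun k' hk' => ?_
    simp [corner, flipCoord_apply, Function.update_of_ne (ne_of_mem_erase hk')]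

theorem IsRFunction.isLevel {M : ℕ} {r : Fin 3 → ℕ} {f : (Fin 3 → ℝ) → ℝ} (hf : IsRFunction r f)
    (k : Fin 3) (hk : r k < M) :
    IsLevel (flipCoord M k) (r k) (fun J => f (corner M J)) := by
  obtain ⟨ε, -, hε⟩ := hf
  constructor
  · intro J
    simp only [hε]
    rw [← sum_neg_distrib]
    refine sum_congr rfl fun R _ => ?_
    rw [haarRect_flipCoord R k (r k) (-1) J (by rw [haar_flipDigit_self hk, neg_one_mul])]
    ring
  · intro i hi J
    simp only [hε]
    refine sum_congr rfl fun R _ => ?_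
    rw [haarRect_flipCoord R k i 1 J (by rw [haar_flipDigit_of_lt hk hi, one_mul]), one_mul]

theorem IsRFunction.abs_le {r : Fin 3 → ℕ} {f : (Fin 3 → ℝ) → ℝ} (hf : IsRFunction r f)
    {x : Fin 3 → ℝ} (hx : ∀ k, 0 ≤ x k) : |f x| ≤ 1 := by
  obtain ⟨ε, hε1, hε⟩ := hf
  rw [hε]
  calc |∑ R, ε R * haarRect r R x| ≤ ∑ R, |ε R * haarRect r R x| := abs_sum_le_sum_abs _ _
    _ = ∑ R : Rect r, ∏ k, |haar (r k) (R k) (x k)| := sum_congr rfl fun R _ => by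
        rw [abs_mul, haarRect, abs_prod]
        rcases hε1 R with h | h <;> simp [h]
    _ = ∏ k, ∑ j : Fin (2 ^ r k), |haar (r k) j (x k)| := by
        rw [prod_univ_sum, Fintype.piFinset_univ]
    _ ≤ 1 := prod_le_one (fun k _ => sum_nonneg fun _ _ => abs_nonneg _)
        fun k _ => sum_abs_haar_le (r k) (hx k)

/-- The dyadic cell of side `2 ^ (-M)` that contains a given point of the unit cube. -/
noncomputable def cell (M : ℕ) (x : Fin 3 → ℝ) (k : Fin 3) : Fin (2 ^ M) :=
  -- The minimum matters in the cube only for `x k = 1`, which is assigned to the last cell.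
  ⟨min ⌊2 ^ M * x k⌋₊ (2 ^ M - 1), by have := Nat.two_pow_pos M; omega⟩

theorem IsRFunction.eq_corner_cell {M : ℕ} {r : Fin 3 → ℕ} {f : (Fin 3 → ℝ) → ℝ}
    (hf : IsRFunction r f) (hr : ∀ k, r k < M) {x : Fin 3 → ℝ} (hx : ∀ k, x k ∈ Set.Ico (0 : ℝ) 1) :
    f x = f (corner M (cell M x)) := by
  obtain ⟨ε, -, hε⟩ := hf
  rw [hε, hε]
  refine sum_congr rfl fun R _ => ?_
  congr 1
  refine prod_congr rfl fun k _ => ?_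
  have hlt : ⌊2 ^ M * x k⌋₊ < 2 ^ M := by
    rw [Nat.floor_lt (by have := (hx k).1; positivity)]
    push_cast
    have := (hx k).2
    nlinarith [pow_pos (two_pos : (0 : ℝ) < 2) M]
  rw [haar_eq_haar_floor (hr k) (hx k).1, corner, cell]
  simp only
  rw [min_eq_left (by omega)]

open MeasureTheory

theorem measurable_cell (M : ℕ) : Measurable (cell M) := by
  refine measurable_pi_lambda _ fun k => ?_
  exact (measurable_from_nat (f := fun a => (⟨min a (2 ^ M - 1), by
    have := Nat.two_pow_pos M; omega⟩ : Fin (2 ^ M)))).comp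
    (Nat.measurable_floor.comp ((measurable_pi_apply k).const_mul _))

theorem cubeMeasure_cell_le (M : ℕ) (J : Fin 3 → Fin (2 ^ M)) :
    cubeMeasure (cell M ⁻¹' {J}) ≤ ENNReal.ofReal (((2 : ℝ) ^ M) ^ 3)⁻¹ := by
  have hpos : (0 : ℝ) < 2 ^ M := by positivity
  rw [cubeMeasure, Measure.restrict_apply (measurable_cell M (measurableSet_singleton J))]
  have hsub : cell M ⁻¹' {J} ∩ Set.Icc 0 1 ⊆
      Set.Icc (corner M J) (fun k => ((J k : ℕ) + 1) / 2 ^ M) := by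
    rintro x ⟨hx, hx0, hx1⟩
    have key : ∀ k, (J k : ℕ) ≤ 2 ^ M * x k ∧ 2 ^ M * x k ≤ (J k : ℕ) + 1 := by
      intro k
      have hx0 : 0 ≤ x k := hx0 k
      have hx1 : x k ≤ 1 := hx1 k
      have hk : (J k : ℕ) = min ⌊2 ^ M * x k⌋₊ (2 ^ M - 1) := by
        rw [← (hx : cell M x = J)]
        rfl
      have h0 : 0 ≤ 2 ^ M * x k := by positivity
      constructor
      · refine le_trans ?_ (Nat.floor_le h0)
        rw [hk]
        exact_mod_cast min_le_left _ _
      · rcases min_choice ⌊2 ^ M * x k⌋₊ (2 ^ M - 1) with h | h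
        · rw [hk, h]
          exact (Nat.lt_floor_add_one _).le
        · rw [hk, h, Nat.cast_sub Nat.one_le_two_pow]
          push_cast
          nlinarith
    refine ⟨fun k => ?_, fun k => ?_⟩
    · rw [corner, div_le_iff₀ hpos, mul_comm]
      exact (key k).1
    · change x k ≤ ((J k : ℕ) + 1) / 2 ^ M
      rw [le_div_iff₀ hpos, mul_comm]
      exact (key k).2
  refine (measure_mono hsub).trans ?_
  rw [Real.volume_Icc_pi]
  have : ∀ k, ((J k : ℕ) + 1 : ℝ) / 2 ^ M - corner M J k = (2 ^ M)⁻¹ := fun k => by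
    rw [corner]
    field_simp
    ring
  simp only [this, prod_const, card_univ, Fintype.card_fin]
  rw [← ENNReal.ofReal_pow (by positivity), inv_pow]

instance : IsProbabilityMeasure cubeMeasure := ⟨by
  rw [cubeMeasure, Measure.restrict_apply_univ, Real.volume_Icc_pi]
  simp⟩

/-- On a probability space the `L^p` norm is at most the `L^k` norm, and the latter is a normalized
grid moment because each cell has measure at most `2 ^ (-3M)`. -/
theorem MomentLE.eLpNorm_le {M k : ℕ} (hk : 1 ≤ k) {Φ : (Fin 3 → Fin (2 ^ M)) → ℝ} {A : ℝ}
    (hA : 0 ≤ A) (h : MomentLE k Φ A) {p : ℝ} (hp : p ≤ k) :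
    eLpNorm (fun x => Φ (cell M x)) (ENNReal.ofReal p) cubeMeasure ≤ ENNReal.ofReal A := by
  have hmeas : Measurable fun x => Φ (cell M x) := (measurable_of_finite Φ).comp (measurable_cell M)
  have hpk : ENNReal.ofReal p ≤ (k : ENNReal) := by
    rw [← ENNReal.ofReal_natCast]
    exact ENNReal.ofReal_le_ofReal hp
  refine (eLpNorm_le_eLpNorm_of_exponent_le hpk hmeas.aestronglyMeasurable).trans ?_
  have hk0 : (k : ENNReal) ≠ 0 := by exact_mod_cast (by omega : k ≠ 0)
  rw [eLpNorm_eq_lintegral_rpow_enorm_toReal hk0 (ENNReal.natCast_ne_top k)]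
  have hk' : (0 : ℝ) < k := by exact_mod_cast hk
  have hint : ∫⁻ x, ‖Φ (cell M x)‖ₑ ^ (k : ENNReal).toReal ∂cubeMeasure ≤
      ENNReal.ofReal A ^ (k : ℝ) := by
    rw [← lintegral_map (f := fun J => ‖Φ J‖ₑ ^ (k : ENNReal).toReal) (measurable_of_finite _)
      (measurable_cell M), lintegral_fintype]
    calc ∑ J, ‖Φ J‖ₑ ^ (k : ENNReal).toReal * (cubeMeasure.map (cell M)) {J}
        ≤ ∑ J, ENNReal.ofReal (|Φ J| ^ k * (((2 : ℝ) ^ M) ^ 3)⁻¹) := by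
          refine sum_le_sum fun J _ => ?_
          rw [Measure.map_apply (measurable_cell M) (measurableSet_singleton J),
            ENNReal.toReal_natCast, ENNReal.rpow_natCast, Real.enorm_eq_ofReal_abs,
            ENNReal.ofReal_mul (by positivity), ENNReal.ofReal_pow (abs_nonneg _)]
          gcongr
          exact cubeMeasure_cell_le M J
      _ = ENNReal.ofReal ((∑ J, |Φ J| ^ k) * (((2 : ℝ) ^ M) ^ 3)⁻¹) := by
          rw [← ENNReal.ofReal_sum_of_nonneg fun _ _ => by positivity, sum_mul]
      _ ≤ ENNReal.ofReal (A ^ k) := by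
          refine ENNReal.ofReal_le_ofReal ?_
          rw [mul_inv_le_iff₀ (by positivity)]
          unfold MomentLE at h
          simpa using h
      _ = _ := by rw [ENNReal.rpow_natCast, ENNReal.ofReal_pow hA]
  calc _ ≤ (ENNReal.ofReal A ^ (k : ℝ)) ^ (1 / (k : ENNReal).toReal) := by gcongr
    _ = ENNReal.ofReal A := by
      rw [ENNReal.toReal_natCast, ← ENNReal.rpow_mul, mul_one_div_cancel hk'.ne', ENNReal.rpow_one]

end Digits

/-! ### From `NSD` to the grid system -/

section Assembly

variable {n q : ℕ}

/-- The parameter `(n - a - b, a, b)`. -/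
def param (n : ℕ) (a b : Fin (n + 1)) : Fin 3 → ℕ := ![n - a - b, a, b]

theorem param_mem_hyp {a b : Fin (n + 1)} (h : (a : ℕ) + b ≤ n) : param n a b ∈ hyp n := by
  rw [hyp, Finset.Nat.mem_antidiagonalTuple, Fin.sum_univ_three]
  simp only [param, Matrix.cons_val]
  omega

open Classical in
theorem sum_NSD_eq (I : Fin q → Finset ℕ) (V : Finset (Fin q)) (F : (Fin 3 → ℕ) → ℝ) :
    ∑ r ∈ NSD n I V, ∏ j, F (r j) =
      ∑ a : V → Fin (n + 1), ∑ b : V → Fin (n + 1), if NoIsolated a b then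
        ∏ j, (if (a j : ℕ) + b j ≤ n ∧ n - a j - b j ∈ I j then F (param n (a j) (b j)) else 0)
      else 0 := by
  have hR : ∀ a b : V → Fin (n + 1), (if NoIsolated a b then
        ∏ j, (if (a j : ℕ) + b j ≤ n ∧ n - a j - b j ∈ I j then F (param n (a j) (b j)) else 0)
      else 0) = if NoIsolated a b ∧ ∀ j, (a j : ℕ) + b j ≤ n ∧ n - a j - b j ∈ I j then
        ∏ j, F (param n (a j) (b j)) else 0 := by
    intro a b
    by_cases h : NoIsolated a b
    · by_cases h' : ∀ j, (a j : ℕ) + b j ≤ n ∧ n - a j - b j ∈ I j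
      · rw [if_pos h, if_pos ⟨h, h'⟩]
        exact prod_congr rfl fun j _ => if_pos (h' j)
      · rw [if_pos h, if_neg fun h2 => h' h2.2]
        push Not at h'
        obtain ⟨j, hj⟩ := h'
        exact prod_eq_zero (mem_univ j) (if_neg fun h2 => hj h2.1 h2.2)
    · rw [if_neg h, if_neg fun h2 => h h2.1]
  simp only [hR]
  rw [← Fintype.sum_prod_type' (f := fun a b : V → Fin (n + 1) =>
    if NoIsolated a b ∧ ∀ j, (a j : ℕ) + b j ≤ n ∧ n - a j - b j ∈ I j then
        ∏ j, F (param n (a j) (b j)) else 0), ← sum_filter]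
  have hmem : ∀ r : V → Fin 3 → ℕ, r ∈ NSD n I V ↔
      (∀ j, r j 0 + r j 1 + r j 2 = n ∧ r j 0 ∈ I j) ∧
        ∀ j : V, ∃ j' : V, j' ≠ j ∧ (r j 1 = r j' 1 ∨ r j 2 = r j' 2) := by
    intro r
    simp only [NSD, block, hyp, mem_filter, Fintype.mem_piFinset,
      Finset.Nat.mem_antidiagonalTuple, Fin.sum_univ_three]
  -- `Fin.ofNat` reduces modulo `n + 1`, which changes nothing since the coordinates are at most
  -- `n`.
  have hval : ∀ {r : V → Fin 3 → ℕ}, r ∈ NSD n I V → ∀ j,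
      (Fin.ofNat (n + 1) (r j 1) : ℕ) = r j 1 ∧ (Fin.ofNat (n + 1) (r j 2) : ℕ) = r j 2 := by
    intro r hr j
    have := ((hmem r).1 hr).1 j
    simp only [Fin.val_ofNat]
    exact ⟨Nat.mod_eq_of_lt (by omega), Nat.mod_eq_of_lt (by omega)⟩
  have hparam : ∀ {r : V → Fin 3 → ℕ}, r ∈ NSD n I V → ∀ j,
      param n (Fin.ofNat (n + 1) (r j 1)) (Fin.ofNat (n + 1) (r j 2)) = r j := by
    intro r hr j
    have h1 := ((hmem r).1 hr).1 j
    have h2 := hval hr j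
    funext k
    fin_cases k
    · simp only [param, Fin.zero_eta, Matrix.cons_val, h2]
      omega
    · simpa [param] using h2.1
    · simpa [param] using h2.2
  refine sum_nbij'
    (fun r => (fun j => Fin.ofNat (n + 1) (r j 1), fun j => Fin.ofNat (n + 1) (r j 2)))
    (fun p j => param n (p.1 j) (p.2 j)) ?_ ?_ ?_ ?_ ?_
  · intro r hr
    have h1 := (hmem r).1 hr
    refine mem_filter.2 ⟨mem_univ _, fun j => ?_, fun j => ?_⟩
    · obtain ⟨j', hj', h⟩ := h1.2 j
      exact ⟨j', hj', h.imp (fun h => by simp only [h]) fun h => by simp only [h]⟩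
    · have h2 := h1.1 j
      have h3 := hval hr j
      simp only [h3]
      refine ⟨by omega, ?_⟩
      rw [show n - r j 1 - r j 2 = r j 0 by omega]
      exact h2.2
  · rintro ⟨a, b⟩ hp
    obtain ⟨-, h1, h2⟩ := mem_filter.1 hp
    simp only at h1 h2
    refine (hmem _).2 ⟨fun j => ?_, fun j => ?_⟩
    · simp only [param, Matrix.cons_val]
      exact ⟨by have := (h2 j).1; omega, (h2 j).2⟩
    · obtain ⟨j', hj', h⟩ := h1 j
      refine ⟨j', hj', ?_⟩
      simp only [param, Matrix.cons_val]
      exact h.imp (fun h => by rw [h]) fun h => by rw [h]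
  · intro r hr
    exact funext fun j => hparam hr j
  · rintro ⟨a, b⟩ hp
    simp [param, Fin.ofNat_eq_cast]
  · intro r hr
    exact prod_congr rfl fun j _ => by rw [hparam hr j]

/-- The functions `f r`, sampled at the dyadic grid and restricted to the blocks. -/
noncomputable def gridSystem (n : ℕ) (I : Fin q → Finset ℕ) (f : (Fin 3 → ℕ) → (Fin 3 → ℝ) → ℝ)
    (V : Finset (Fin q)) (j : V) (a b : Fin (n + 1)) (J : Fin 3 → Fin (2 ^ (n + 1))) : ℝ :=
  if (a : ℕ) + b ≤ n ∧ n - a - b ∈ I j then f (param n a b) (corner (n + 1) J) else 0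

theorem haarSystem_gridSystem {I : Fin q → Finset ℕ} (hI : IsIntervalDivision n I)
    {f : (Fin 3 → ℕ) → (Fin 3 → ℝ) → ℝ} (hf : ∀ r ∈ hyp n, IsRFunction r (f r))
    (V : Finset (Fin q)) : HaarSystem n (flipCoord (n + 1)) (gridSystem n I f V) := by
  have hcases : ∀ (j : V) (a b : Fin (n + 1)), (((a : ℕ) + b ≤ n ∧ n - a - b ∈ I j) ∧
      gridSystem n I f V j a b = fun J => f (param n a b) (corner (n + 1) J)) ∨
      gridSystem n I f V j a b = fun _ => 0 := by
    intro j a b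
    by_cases h : (a : ℕ) + b ≤ n ∧ n - a - b ∈ I j
    · exact Or.inl ⟨h, funext fun J => if_pos h⟩
    · exact Or.inr (funext fun J => if_neg h)
  have hne : ∀ {j : V} {a b : Fin (n + 1)}, gridSystem n I f V j a b ≠ 0 →
      (a : ℕ) + b ≤ n ∧ n - a - b ∈ I j := fun {j a b} h =>
    ((hcases j a b).resolve_right h).1
  have hlev : ∀ j (a b : Fin (n + 1)) k,
      IsLevel (flipCoord (n + 1) k) (param n a b k) (gridSystem n I f V j a b) := by
    intro j a b k
    rcases hcases j a b with ⟨h, h'⟩ | h'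
    · rw [h']
      refine (hf _ (param_mem_hyp h.1)).isLevel k ?_
      fin_cases k <;> simp [param] <;> omega
    · rw [h']
      exact IsLevel.zero _ _
  constructor
  · intro j a b J
    rcases hcases j a b with ⟨h, h'⟩ | h' <;> rw [h']
    · refine (hf _ (param_mem_hyp h.1)).abs_le fun k => ?_
      rw [corner]
      positivity
    · simp
  · exact fun j a b => hlev j a b 0
  · exact fun j a b => hlev j a b 1
  · exact fun j a b => hlev j a b 2
  · exact fun h => (hne h).1
  · intro i j a b a' b' hij h h'
    have h1 := hne h
    have h2 := hne h'
    have := hI.increasing i j hij _ h1.2 _ h2.2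
    omega

/-- All parameters are at most `n`, so the functions are constant on cells of side `2 ^ (-(n + 1))`
of the half-open cube. The upper faces form a null set. -/
theorem sumProd_NSD_ae_eq {I : Fin q → Finset ℕ} {f : (Fin 3 → ℕ) → (Fin 3 → ℝ) → ℝ}
    (hf : ∀ r ∈ hyp n, IsRFunction r (f r)) (V : Finset (Fin q)) [h : ∀ a b : V → Fin (n + 1),
      Decidable (NoIsolated a b)] :
    sumProd f (NSD n I V) =ᵐ[cubeMeasure] fun x =>
      ∑ a : V → Fin (n + 1), ∑ b : V → Fin (n + 1), if NoIsolated a b then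
        ∏ j, gridSystem n I f V j (a j) (b j) (cell (n + 1) x) else 0 := by
  have hset : (Set.Icc 0 1 : Set (Fin 3 → ℝ)) =ᵐ[MeasureTheory.volume]
      Set.univ.pi fun _ => Set.Ico (0 : ℝ) 1 :=
    (MeasureTheory.Measure.univ_pi_Ico_ae_eq_Icc (f := (0 : Fin 3 → ℝ)) (g := 1)).symm
  rw [cubeMeasure, MeasureTheory.Measure.restrict_congr_set hset]
  filter_upwards [MeasureTheory.ae_restrict_mem
    (MeasurableSet.univ_pi fun _ => measurableSet_Ico)] with x hx
  rw [sumProd, sum_NSD_eq I V fun r => f r x]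
  refine sum_congr rfl fun a _ => sum_congr rfl fun b _ => ?_
  congr 1
  refine prod_congr rfl fun j _ => ?_
  unfold gridSystem
  split_ifs with hc
  · refine (hf _ (param_mem_hyp hc.1)).eq_corner_cell (fun k => ?_) fun k => hx k (Set.mem_univ k)
    fin_cases k <;> simp [param] <;> omega
  · rfl

theorem eLpNorm_sumProd_NSD_le {I : Fin q → Finset ℕ} (hI : IsIntervalDivision n I)
    {f : (Fin 3 → ℕ) → (Fin 3 → ℝ) → ℝ} (hf : ∀ r ∈ hyp n, IsRFunction r (f r))
    {V : Finset (Fin q)} (hV : V.Nonempty) {m : ℕ} (hm : 1 ≤ m) {p : ℝ} (hp : p ≤ 2 * m) {t : ℝ}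
    (ht : 1 ≤ t) (htn : t ^ 16 = n + 1) :
    MeasureTheory.eLpNorm (sumProd f (NSD n I V)) (ENNReal.ofReal p) cubeMeasure ≤
      ENNReal.ofReal ((216 * m ^ 3 * #V ^ 8 * t ^ 15) ^ #V) := by
  classical
  have : Nonempty V := hV.to_subtype
  have hmom := (haarSystem_gridSystem hI hf V).noIsolated_sum_le hm ht htn
  rw [Fintype.card_coe] at hmom
  rw [MeasureTheory.eLpNorm_congr_ae (sumProd_NSD_ae_eq hf V)]
  refine hmom.eLpNorm_le (by omega) ?_ (by push_cast; exact hp)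
  have : 0 < t := by linarith
  positivity

end Assembly
end BeckGain

/-! ### The final estimate and its constants -/

theorem mainTheorem3 :
    ∃ C₀ C₁ C₂ C₃ η : ℝ, 0 < C₀ ∧ 0 < C₁ ∧ 0 < C₂ ∧ 0 < C₃ ∧ 0 < η ∧
      ∀ (n q : ℕ) (_ : 1 ≤ n) (I : Fin q → Finset ℕ) (_ : BeckGain.IsIntervalDivision n I)
        (f : (Fin 3 → ℕ) → (Fin 3 → ℝ) → ℝ)
        (_ : ∀ r ∈ BeckGain.hyp n, BeckGain.IsRFunction r (f r))
        (V : Finset (Fin q)) (p : ℝ) (_ : 1 ≤ p),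
        ENNReal.ofReal (BeckGain.rho q n ^ V.card) *
            MeasureTheory.eLpNorm (BeckGain.sumProd f (BeckGain.NSD n I V))
              (ENNReal.ofReal p) BeckGain.cubeMeasure ≤
          ENNReal.ofReal
            ((C₀ * (V.card : ℝ) ^ C₁ * p ^ C₂ * (q : ℝ) ^ C₃ * (n : ℝ) ^ (-η)) ^ V.card) := by
  -- The factor `2 ^ 3` comes from `m ≤ 2 * p`, and `432 = 2 * 216` from `t ^ 15 / n ≤ 2 * n ^
  -- (-1/16)`; the exponent `1 / 2` is the square root in `rho`.
  refine ⟨432 * 2 ^ 3, 8, 3, 1 / 2, 1 / 16, by norm_num, by norm_num, by norm_num, by norm_num,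
    by norm_num, ?_⟩
  intro n q hn I hI f hf V p hp
  rcases V.eq_empty_or_nonempty with rfl | hV
  · have h1 : BeckGain.sumProd f (BeckGain.NSD n I ∅) = fun _ => 1 := by
      funext x
      simp [BeckGain.sumProd, BeckGain.NSD]
    have hp0 : ENNReal.ofReal p ≠ 0 := by
      rw [ne_eq, ENNReal.ofReal_eq_zero]
      linarith
    rw [h1, MeasureTheory.eLpNorm_const _ hp0 (MeasureTheory.IsProbabilityMeasure.ne_zero _)]
    simp
  set m := ⌈p⌉₊ with hm
  have hpm : p ≤ m := Nat.le_ceil p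
  have hm1 : 1 ≤ m := Nat.one_le_ceil_iff.2 (by linarith)
  have hm2 : (m : ℝ) ≤ 2 * p := by
    have := (Nat.ceil_lt_add_one (by linarith : 0 ≤ p)).le
    linarith
  -- The sixteenth root turns all the exponents of `n + 1` above into natural powers of `t`.
  set t : ℝ := ((n : ℝ) + 1) ^ (1 / 16 : ℝ) with htdef
  have hn1 : (1 : ℝ) ≤ n := by exact_mod_cast hn
  have ht1 : 1 ≤ t := Real.one_le_rpow (by linarith) (by norm_num)
  have ht0 : 0 < t := by linarith
  have htn : t ^ 16 = n + 1 := by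
    rw [htdef, ← Real.rpow_natCast, ← Real.rpow_mul (by positivity)]
    norm_num
  have hLp := BeckGain.eLpNorm_sumProd_NSD_le hI hf hV hm1 (p := p) (by linarith) ht1 htn
  have hrho : 0 ≤ BeckGain.rho q n := by
    unfold BeckGain.rho
    positivity
  refine (mul_le_mul_right hLp _).trans ?_
  rw [← ENNReal.ofReal_mul (by positivity), ← mul_pow]
  refine ENNReal.ofReal_le_ofReal (pow_le_pow_left₀ (by positivity) ?_ _)
  have hq : Real.sqrt q = (q : ℝ) ^ (1 / 2 : ℝ) := Real.sqrt_eq_rpow _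
  have hV8 : (V.card : ℝ) ^ (8 : ℝ) = (V.card : ℝ) ^ 8 := by
    exact_mod_cast Real.rpow_natCast (V.card : ℝ) 8
  have hp3 : p ^ (3 : ℝ) = p ^ 3 := by exact_mod_cast Real.rpow_natCast p 3
  have hnt : t ^ 15 / n ≤ 2 * (n : ℝ) ^ (-(1 / 16) : ℝ) := by
    have h1 : (n : ℝ) ^ (1 / 16 : ℝ) ≤ t := Real.rpow_le_rpow (by linarith) (by linarith)
      (by norm_num)
    have h2 : (0 : ℝ) < (n : ℝ) ^ (1 / 16 : ℝ) := by positivity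
    rw [Real.rpow_neg (by positivity), ← div_eq_mul_inv, div_le_div_iff₀ (by positivity) h2]
    calc t ^ 15 * (n : ℝ) ^ (1 / 16 : ℝ) ≤ t ^ 15 * t := by gcongr
      _ = (n : ℝ) + 1 := by rw [← htn]; ring
      _ ≤ 2 * (n : ℝ) := by linarith
  rw [hV8, hp3, BeckGain.rho, hq]
  calc (q : ℝ) ^ (1 / 2 : ℝ) / n * (216 * m ^ 3 * V.card ^ 8 * t ^ 15)
      = (216 * m ^ 3 * V.card ^ 8 * (q : ℝ) ^ (1 / 2 : ℝ)) * (t ^ 15 / n) := by ring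
    _ ≤ (216 * (2 * p) ^ 3 * V.card ^ 8 * (q : ℝ) ^ (1 / 2 : ℝ)) *
        (2 * (n : ℝ) ^ (-(1 / 16) : ℝ)) := by gcongr
    _ = _ := by ring
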